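/- **Theorem 2 (Time complexity of AESP).** Let $G=(V,E)$ be a finite connected undirected simple graph with at least two nodes, $m=|E|$, adjacency matrix $A$, degrees $d_v$, $D=\mathrm{diag}(d_v)$ and $\operatorname{vol}(S)=\sum_{v\in S}d_v$. Let $0<\alpha<1/2$, $\mu=\alpha$, $L=1$, $\eta=L-2\mu$, $b\in\mathbb R^V$, and let $\varepsilon>0$ satisfy $\{i:|b_i|\ge\varepsilon d_i\}\neq\emptyset$. Put $Q=\frac{1+\alpha}{2}I-\frac{1-\alpha}{2}D^{-1/2}AD^{-1/2}$, $f(x)=\frac12x^\top Qx-\alpha x^\top D^{-1/2}b$, with minimizer $x_f^*=\alpha Q^{-1}D^{-1/2}b$, and $q=\mu/(\mu+\eta)$, $\rho=0.9\sqrt q$, $\tau=\frac{2(\alpha+\eta)}{1+\alpha+2\eta}$. *Algorithm AESP.* Start from $x^{(0)}=y^{(0)}=0$ and let $T_{\max}=\Big\lfloor\frac1\rho\log\frac{4(L+\mu)\|b\|_1^2}{\mu\varepsilon^2(\sqrt q-\rho)^2}\Big\rfloor$. For $t=1,\dots,T_{\max}$: let $\varphi_t=(L+\mu)\|b\|_1^2(1-\rho)^t/18$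 and $h_t(z)=f(z)+\frac\eta2\|z-y^{(t-1)}\|_2^2$. Starting from $z_t^{(0)}=y^{(t-1)}$, let $C_t^k=\|D^{1/2}\nabla h_t(z_t^{(k)})\|_1$, $\varepsilon_t=\max\{\sqrt{(\mu+\eta)\varphi_t/m},\,2(\eta+\alpha)\varphi_t/C_t^0\}$ (only the first entry if $C_t^0=0$) and $S_t^{(k)}=\{u:|\nabla_uh_t(z_t^{(k)})|\ge\varepsilon_t\sqrt{d_u}\}$. The local solver $\mathcal M$ is either LocGD, $z_t^{(k+1)}=z_t^{(k)}-\frac{2}{1+\alpha+2\eta}\nabla h_t(z_t^{(k)})\circ 1_{S_t^{(k)}}$, or LocAPPR, which obtains $z_t^{(k+1)}$ from $z_t^{(k)}$ by going through the nodes $u$ of $S_t^{(k)}$ one after the other, in an arbitrary order, and replacing the current point $w$ by $w-\frac{2}{1+\alpha+2\eta}\nabla h_t(w)\circ 1_{\{u\}}$. Let $K_t$ be the first $k$ with $S_t^{(k)}=\emptyset$ and set $x^{(t)}=z_t^{(K_t)}$. Stop if $|\nabla_vf(x^{(t)})|<\varepsilon\alpha\sqrt{d_v}$ for all $v$; otherwise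 set $y^{(t)}=x^{(t)}+\frac{\sqrt{\mu+\eta}-\sqrt\mu}{\sqrt{\mu+\eta}+\sqrt\mu}(x^{(t)}-x^{(t-1)})$ and continue. Let $T$ be the number of outer iterations performed and $\hat x=x^{(T)}$. The work of stage $t$ is $\mathcal T_t=\sum_{k<K_t}\operatorname{vol}(S_t^{(k)})$. Let $\overline{\operatorname{vol}}(S_t)=\frac1{K_t}\sum_{k<K_t}\operatorname{vol}(S_t^{(k)})$ and $\bar\gamma_t=\frac1{K_t}\sum_{k<K_t}\|D^{1/2}\nabla h_t(z_t^{(k)})\circ 1_{S_t^{(k)}}\|_1/C_t^k$. *Claim.* $x_f^*$ is the unique minimizer of $f$, $T\ge 1$, every $K_t$ with $1\le t\le T$ exists, $\|D^{-1/2}(\hat x-x_f^*)\|_\infty\le\varepsilon$, and $$\sum_{t=1}^T\mathcal T_t\le\sum_{t=1}^T\min\Big\{\frac{\overline{\operatorname{vol}}(S_t)}{\tau\bar\gamma_t}\log\frac{C_t^0}{C_t^{K_t}},\ \frac{C_t^0-C_t^{K_t}}{\tau\varepsilon_t}\Big\},\qquad \frac{\overline{\operatorname{vol}}(S_t)}{\bar\gamma_t}\le\min\Big\{\frac{C_t^0}{\varepsilon_t},2m\Big\}\quad(1\le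 t\le T),$$ where a logarithm $\log(C_t^0/0)$ is $+\infty$ and a stage with $K_t=0$ contributes $0$ throughout. For LocAPPR the first bound also holds with $\bar\gamma_t$ replaced by $\frac1{K_t}$ times the sum, over all single-node updates of stage $t$, of $\sqrt{d_u}\,|\nabla_uh_t(w)|/\|D^{1/2}\nabla h_t(w)\|_1$, where $w$ is the point just before node $u$ is updated. Furthermore $q=\mu/(L-\mu)$ and $$T\le T_{\max}\le\frac{10}{9\sqrt q}\log\Big(\frac{400(L+\mu)\|b\|_1^2}{\mu\varepsilon^2q}\Big)\le\frac{20}{9\sqrt\alpha}\log\Big(\frac{20\|b\|_1}{\alpha\varepsilon}\Big)=\tilde{\mathcal O}\Big(\frac1{\sqrt\alpha}\Big).$$ -/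

import Mathlib

open scoped BigOperators

noncomputable section

namespace LocalPPR

variable {V : Type*} [Fintype V] [DecidableEq V]
variable (G : SimpleGraph V) [DecidableRel G.Adj] (α : ℝ) (b : V → ℝ) (η : ℝ)

/-! ### The quadratic problem -/

/-- The volume `∑ v ∈ S, d_v` of a set of nodes. -/
def vol (S : Finset V) : ℝ := ∑ v ∈ S, (G.degree v : ℝ)

/-- The diagonal matrix `D^{-1/2}`. -/
def invSqrtDeg : Matrix V V ℝ := Matrix.diagonal fun v => (Real.sqrt (G.degree v))⁻¹

/-- `Q = (1+α)/2 • I - (1-α)/2 • D^{-1/2} A D^{-1/2}`. -/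
def sysMatrix : Matrix V V ℝ :=
  ((1 + α) / 2) • (1 : Matrix V V ℝ) -
    ((1 - α) / 2) • (invSqrtDeg G * G.adjMatrix ℝ * invSqrtDeg G)

/-- `f(x) = (1/2) xᵀ Q x - α xᵀ D^{-1/2} b`; it is `μ`-strongly convex and `L`-smooth with
`μ = α` and `L = 1`. -/
def objective (x : V → ℝ) : ℝ :=
  1 / 2 * (x ⬝ᵥ (sysMatrix G α).mulVec x) - α * (x ⬝ᵥ (invSqrtDeg G).mulVec b)

/-- `∇f(x) = Q x - α D^{-1/2} b`. -/
def gradObjective (x : V → ℝ) : V → ℝ :=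
  (sysMatrix G α).mulVec x - α • (invSqrtDeg G).mulVec b

/-- The optimal solution `x_f^* = α Q⁻¹ D^{-1/2} b`. -/
def optSolution : V → ℝ := α • ((sysMatrix G α)⁻¹).mulVec ((invSqrtDeg G).mulVec b)

/-- The proximal objective `h(z) = f(z) + (η/2) ‖z - y‖₂²` with centre `y`. -/
def proxObjective (y z : V → ℝ) : ℝ :=
  objective G α b z + η / 2 * ∑ v, (z v - y v) ^ 2

/-- `∇h(z) = ∇f(z) + η (z - y)`. -/
def gradProx (y z : V → ℝ) : V → ℝ := gradObjective G α b z + η • (z - y)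

theorem sysMatrix_isSymm : (sysMatrix G α).IsSymm := by
  unfold sysMatrix invSqrtDeg Matrix.IsSymm
  rw [Matrix.transpose_sub, Matrix.transpose_smul, Matrix.transpose_smul, Matrix.transpose_one,
    Matrix.transpose_mul, Matrix.transpose_mul, Matrix.diagonal_transpose,
    SimpleGraph.transpose_adjMatrix, Matrix.mul_assoc]

/-- `gradProx` is the gradient of `proxObjective`: exact second-order expansion. -/
theorem proxObjective_add (y z w : V → ℝ) :
    proxObjective G α b η y (z + w) = proxObjective G α b η y z + gradProx G α b η y z ⬝ᵥ w +
      (1 / 2 * (w ⬝ᵥ (sysMatrix G α).mulVec w) + η / 2 * ∑ v, w v ^ 2) := by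
  have hs : w ⬝ᵥ (sysMatrix G α).mulVec z = z ⬝ᵥ (sysMatrix G α).mulVec w := by
    rw [dotProduct_comm w, ← Matrix.vecMul_transpose, ← Matrix.dotProduct_mulVec,
      (sysMatrix_isSymm G α).eq]
  have hc : (sysMatrix G α).mulVec z ⬝ᵥ w = w ⬝ᵥ (sysMatrix G α).mulVec z := dotProduct_comm _ _
  have hb : (invSqrtDeg G).mulVec b ⬝ᵥ w = w ⬝ᵥ (invSqrtDeg G).mulVec b := dotProduct_comm _ _
  have h1 : ∑ v, ((z + w) v - y v) ^ 2 =
      ∑ v, (z v - y v) ^ 2 + 2 * ((z - y) ⬝ᵥ w) + ∑ v, w v ^ 2 := by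
    rw [dotProduct, Finset.mul_sum, ← Finset.sum_add_distrib, ← Finset.sum_add_distrib]
    exact Finset.sum_congr rfl fun v _ => by simp only [Pi.add_apply, Pi.sub_apply]; ring
  simp only [proxObjective, objective, gradProx, gradObjective, h1, Matrix.mulVec_add,
    add_dotProduct, dotProduct_add, sub_dotProduct, smul_dotProduct, smul_eq_mul, hc, hb, hs]
  ring

/-- `‖D^{1/2} ∇h(z)‖₁`. -/
def scaledGradNorm (y z : V → ℝ) : ℝ :=
  ∑ v, Real.sqrt (G.degree v) * |gradProx G α b η y z v|

/-- `‖b‖₁`. -/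
def norm1 (x : V → ℝ) : ℝ := ∑ v, |x v|

/-! ### The local solvers -/

/-- A rule that, at outer stage `t` and inner round `k`, lists the nodes of a finite set in some
order, each exactly once. -/
structure ProcessingOrder (V : Type*) where
  list : ℕ → ℕ → Finset V → List V
  nodup : ∀ t k S, (list t k S).Nodup
  mem_iff : ∀ t k S v, v ∈ list t k S ↔ v ∈ S

/-- The two local solvers; for LocAPPR the order in which the nodes of an active set are
processed is arbitrary. -/
inductive LocalSolver (V : Type*) where
  | locGD : LocalSolver V
  | locAPPR : ProcessingOrder V → LocalSolver V

/-- The accuracy `ε_t = max {√((μ+η) φ / m), 2 (η+α) φ / ‖D^{1/2} ∇h(z⁽⁰⁾)‖₁}` with `μ = α` and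
`z⁽⁰⁾ = y`. -/
def innerTol (φ : ℝ) (y : V → ℝ) : ℝ :=
  max (Real.sqrt ((α + η) * φ / (G.edgeFinset.card : ℝ)))
    (2 * (η + α) * φ / scaledGradNorm G α b η y y)

/-- The active set `{u : |∇_u h(z)| ≥ e √d_u}`. -/
def activeSet (e : ℝ) (y z : V → ℝ) : Finset V :=
  open Classical in
  Finset.univ.filter fun u => e * Real.sqrt (G.degree u) ≤ |gradProx G α b η y z u|

/-- A gradient step restricted to `S`: `z - 2 (∇h(z) ∘ 1_S) / (1 + α + 2η)`. -/
def localStep (S : Finset V) (y z : V → ℝ) : V → ℝ := fun u =>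
  if u ∈ S then z u - 2 * gradProx G α b η y z u / (1 + α + 2 * η) else z u

/-- One round on the active set `S`: LocGD makes one simultaneous step on `S`, LocAPPR makes
successive single-node steps on the nodes of `S`, each with the gradient at the current point. -/
def innerRound (M : LocalSolver V) (t k : ℕ) (S : Finset V) (y z : V → ℝ) : V → ℝ :=
  match M with
  | .locGD => localStep G α b η S y z
  | .locAPPR σ => (σ.list t k S).foldl (fun w u => localStep G α b η {u} y w) z

/-- The iterates `z⁽ᵏ⁾` of the solver at stage `t` with accuracy `e`, centre `y`, and `z⁽⁰⁾ = y`. -/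
def innerIter (M : LocalSolver V) (t : ℕ) (e : ℝ) (y : V → ℝ) : ℕ → V → ℝ
  | 0 => y
  | k + 1 => innerRound G α b η M t k (activeSet G α b η e y (innerIter M t e y k)) y
      (innerIter M t e y k)

/-- The number of rounds of the solver: the first `k` at which the active set is empty. -/
def innerCount (M : LocalSolver V) (t : ℕ) (e : ℝ) (y : V → ℝ) : ℕ :=
  sInf {k | activeSet G α b η e y (innerIter G α b η M t e y k) = ∅}

/-- The output of the solver for the target precision `φ`. -/
def solve (M : LocalSolver V) (t : ℕ) (φ : ℝ) (y : V → ℝ) : V → ℝ :=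
  innerIter G α b η M t (innerTol G α b η φ y) y
    (innerCount G α b η M t (innerTol G α b η φ y) y)

/-! ### The outer loop -/

/-- `q = μ / (μ + η)` with `μ = α`. -/
def qRatio : ℝ := α / (α + η)

/-- `ρ = 0.9 √q`. -/
def rhoRate : ℝ := 9 / 10 * Real.sqrt (qRatio α η)

/-- `φ_t = (L + μ) ‖b‖₁² (1 - ρ)^t / 18` with `L = 1`, `μ = α`. -/
def outerTol (t : ℕ) : ℝ := (1 + α) * norm1 b ^ 2 * (1 - rhoRate α η) ^ t / 18

/-- The momentum weight `(√(μ+η) - √μ) / (√(μ+η) + √μ)` with `μ = α`. -/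
def momentum : ℝ :=
  (Real.sqrt (α + η) - Real.sqrt α) / (Real.sqrt (α + η) + Real.sqrt α)

/-- The pair `(x⁽ᵗ⁾, y⁽ᵗ⁾)` of the outer loop. -/
def outerState (M : LocalSolver V) : ℕ → (V → ℝ) × (V → ℝ)
  | 0 => (0, 0)
  | t + 1 =>
    let x' := solve G α b η M (t + 1) (outerTol α b η (t + 1)) (outerState M t).2
    (x', x' + momentum α η • (x' - (outerState M t).1))

/-- The prescribed maximal number of outer iterations: the integer part of
`(1/ρ) log (4 (L+μ) ‖b‖₁² / (μ ε² (√q - ρ)²))` with `L = 1`, `μ = α`. -/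
def outerBudget (ε : ℝ) : ℕ :=
  ⌊1 / rhoRate α η * Real.log (4 * (1 + α) * norm1 b ^ 2 /
    (α * ε ^ 2 * (Real.sqrt (qRatio α η) - rhoRate α η) ^ 2))⌋₊

/-- The early stopping test `{v : ε α √d_v ≤ |∇_v f(x)|} = ∅`. -/
def StopTest (ε : ℝ) (x : V → ℝ) : Prop :=
  ∀ v, ¬ ε * α * Real.sqrt (G.degree v) ≤ |gradObjective G α b x v|

/-- The number of outer iterations that are performed: the first `t ≥ 1` that passes the early
stopping test, but at most the prescribed number. -/
def outerCount (M : LocalSolver V) (ε : ℝ) : ℕ :=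
  sInf {t | t = outerBudget α b η ε ∨ (1 ≤ t ∧ StopTest G α b ε (outerState G α b η M t).1)}

/-- The vector returned by the algorithm. -/
def output (M : LocalSolver V) (ε : ℝ) : V → ℝ :=
  (outerState G α b η M (outerCount G α b η M ε)).1

/-! ### The quantities attached to stage `t ≥ 1` -/

/-- `y⁽ᵗ⁻¹⁾`, the centre of stage `t`. -/
def stageCentre (M : LocalSolver V) (t : ℕ) : V → ℝ := (outerState G α b η M (t - 1)).2

/-- `ε_t`. -/
def stageTol (M : LocalSolver V) (t : ℕ) : ℝ :=
  innerTol G α b η (outerTol α b η t) (stageCentre G α b η M t)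

/-- `z_t⁽ᵏ⁾`. -/
def stageIter (M : LocalSolver V) (t k : ℕ) : V → ℝ :=
  innerIter G α b η M t (stageTol G α b η M t) (stageCentre G α b η M t) k

/-- `S_t⁽ᵏ⁾`. -/
def stageSet (M : LocalSolver V) (t k : ℕ) : Finset V :=
  activeSet G α b η (stageTol G α b η M t) (stageCentre G α b η M t) (stageIter G α b η M t k)

/-- `K_t`. -/
def stageCount (M : LocalSolver V) (t : ℕ) : ℕ :=
  innerCount G α b η M t (stageTol G α b η M t) (stageCentre G α b η M t)

/-- `C_{h_t}^k = ‖D^{1/2} ∇h_t(z_t⁽ᵏ⁾)‖₁`. -/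
def stageNorm (M : LocalSolver V) (t k : ℕ) : ℝ :=
  scaledGradNorm G α b η (stageCentre G α b η M t) (stageIter G α b η M t k)

/-- The work of stage `t`: the sum of the volumes of its active sets. -/
def stageWork (M : LocalSolver V) (t : ℕ) : ℝ :=
  ∑ k ∈ Finset.range (stageCount G α b η M t), vol G (stageSet G α b η M t k)

/-- The average volume of the active sets of stage `t`. -/
def avgVol (M : LocalSolver V) (t : ℕ) : ℝ :=
  1 / (stageCount G α b η M t : ℝ) *
    ∑ k ∈ Finset.range (stageCount G α b η M t), vol G (stageSet G α b η M t k)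

/-- `γ_t⁽ᵏ⁾ = ‖D^{1/2} ∇h_t(z_t⁽ᵏ⁾) ∘ 1_{S_t⁽ᵏ⁾}‖₁ / ‖D^{1/2} ∇h_t(z_t⁽ᵏ⁾)‖₁`. -/
def gradRatio (M : LocalSolver V) (t k : ℕ) : ℝ :=
  (∑ v ∈ stageSet G α b η M t k, Real.sqrt (G.degree v) *
    |gradProx G α b η (stageCentre G α b η M t) (stageIter G α b η M t k) v|) /
    stageNorm G α b η M t k

/-- The average gradient ratio `γ̄_t`. -/
def avgRatio (M : LocalSolver V) (t : ℕ) : ℝ :=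
  1 / (stageCount G α b η M t : ℝ) *
    ∑ k ∈ Finset.range (stageCount G α b η M t), gradRatio G α b η M t k

/-- The sum of the single-node gradient ratios `√d_u |∇_u h(w)| / ‖D^{1/2} ∇h(w)‖₁` met while the
nodes `u` of a list are processed one after the other, where `w` is the point just before `u` is
processed. -/
def sequentialRatio (y : V → ℝ) : List V → (V → ℝ) → ℝ
  | [], _ => 0
  | u :: l, w =>
    Real.sqrt (G.degree u) * |gradProx G α b η y w u| / scaledGradNorm G α b η y w +
      sequentialRatio y l (localStep G α b η {u} y w)

/-- The gradient ratio of round `k` of stage `t` measured along the updates that the solver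
makes: the ratio `γ_t⁽ᵏ⁾` for LocGD, the sum of the single-node ratios for LocAPPR. -/
def updateRatio (M : LocalSolver V) (t k : ℕ) : ℝ :=
  match M with
  | .locGD => gradRatio G α b η .locGD t k
  | .locAPPR σ => sequentialRatio G α b η (stageCentre G α b η (.locAPPR σ) t)
      (σ.list t k (stageSet G α b η (.locAPPR σ) t k)) (stageIter G α b η (.locAPPR σ) t k)

/-- The average over the rounds of stage `t` of `updateRatio`. -/
def avgUpdateRatio (M : LocalSolver V) (t : ℕ) : ℝ :=
  1 / (stageCount G α b η M t : ℝ) *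
    ∑ k ∈ Finset.range (stageCount G α b η M t), updateRatio G α b η M t k

/-- `τ = 2 (α + η) / (1 + α + 2η)`. -/
def tauRate : ℝ := 2 * (α + η) / (1 + α + 2 * η)

/-- `min {v̄ / (τ γ) · log (C⁰ / C^K), (C⁰ - C^K) / (τ ε_t)}` for stage `t`, where `v̄` is the average
volume and `γ` a given average ratio. If `C^K = 0`, the first entry is `+∞`, so that the minimum
is the second entry. -/
def stageBound (M : LocalSolver V) (γ : ℝ) (t : ℕ) : ℝ :=
  let C₀ := stageNorm G α b η M t 0
  let C₁ := stageNorm G α b η M t (stageCount G α b η M t)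
  if C₁ = 0 then (C₀ - C₁) / (tauRate α η * stageTol G α b η M t)
  else min (avgVol G α b η M t / (tauRate α η * γ) * Real.log (C₀ / C₁))
    ((C₀ - C₁) / (tauRate α η * stageTol G α b η M t))

end LocalPPR

end

namespace LocalPPR

variable {V : Type*} [Fintype V] {G : SimpleGraph V} [DecidableRel G.Adj]

/-! Inner stages. Write `r = D^{1/2} ∇h`. The step size is the inverse of the constant diagonal of
`Q + ηI`, so a step on `S` erases `r` on `S` and sends `(1 - τ) r_w / d_w` from each `w ∈ S` to its
neighbours. Hence `‖r‖₁` drops by at least `τ` times the mass of `r` on `S`. For LocAPPR the same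
drop, measured by the gradient at the start of the round, follows by induction with weights in `[0,
1]` (`weighted_scaledGradNorm_localStep_le`, `scaledGradNorm_foldl_le`). Active nodes carry mass at
least `ε_t vol(S)`, so telescoping `C^k` gives termination and the bound `(C⁰ - C^K) / (τ ε_t)`;
telescoping `log C^k` instead gives the logarithmic bound (`stageWork_le_stageBound`).

Outer loop. An empty active set forces `‖∇h_t‖² ≤ 2(μ+η)φ_t`, so each stage is an inexact proximal
step. For the potential `E = f(x) - f* + (μ/2)‖v - x*‖²` this yields `√E_{t+1} ≤ √(1-√q) √E_t +
2√φ_{t+1}` (`sqrt_potential_step_le`). Since `ρ < √q`, the tolerances decay more slowly than the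
homogeneous part, and `E_t` decays like `(1-ρ)^t`. Strong convexity then gives the accuracy once the
budget is exhausted; if the stopping test fires earlier, the accuracy comes from a maximum principle
for `Q` (`error_le_of_stopTest`). -/

theorem sum_sum_neighborFinset (F : V → ℝ) :
    ∑ v, ∑ w ∈ G.neighborFinset v, F w = ∑ w, (G.degree w : ℝ) * F w := by
  rw [Finset.sum_comm' (t' := Finset.univ) (s' := fun w => G.neighborFinset w)]
  · simp
  · intro x y
    simp [SimpleGraph.adj_comm]

theorem sqrt_degree_pos (hd : ∀ v, 0 < G.degree v) (v : V) : 0 < Real.sqrt (G.degree v) :=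
  Real.sqrt_pos.2 (by exact_mod_cast hd v)

theorem sqrt_mul_abs (d x : ℝ) : Real.sqrt d * |x| = |Real.sqrt d * x| := by
  rw [abs_mul, abs_of_nonneg (Real.sqrt_nonneg d)]

variable [DecidableEq V] {α : ℝ} {b : V → ℝ} {η : ℝ}

/-! ### The system matrix -/

theorem sysMatrix_mulVec_apply (x : V → ℝ) (v : V) :
    (sysMatrix G α).mulVec x v = (1 + α) / 2 * x v - (1 - α) / 2 *
      ∑ w ∈ G.neighborFinset v, (Real.sqrt (G.degree v))⁻¹ * ((Real.sqrt (G.degree w))⁻¹ * x w) := by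
  simp only [sysMatrix, invSqrtDeg, Matrix.sub_mulVec, Matrix.smul_mulVec, Matrix.one_mulVec,
    ← Matrix.mulVec_mulVec, Pi.sub_apply, Pi.smul_apply, Matrix.mulVec_diagonal,
    SimpleGraph.adjMatrix_mulVec_apply, smul_eq_mul, Finset.mul_sum]

/-- With `p = D^{-1/2} x`, the estimate `p_v p_w ≤ (p_v² + p_w²)/2` summed over adjacent pairs gives
at most `∑ d_v p_v² = ‖x‖²`. So the normalized adjacency form is at most the identity, and `(1+α)/2
- (1-α)/2 = α` remains. -/
theorem mul_dotProduct_self_le (hd : ∀ v, 0 < G.degree v) (hα1 : α ≤ 1) (x : V → ℝ) :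
    α * ∑ v, x v ^ 2 ≤ x ⬝ᵥ (sysMatrix G α).mulVec x := by
  set p : V → ℝ := fun v => (Real.sqrt (G.degree v))⁻¹ * x v with hp
  have hpd (v : V) : (G.degree v : ℝ) * p v ^ 2 = x v ^ 2 := by
    have h := sqrt_degree_pos hd v
    have h2 : (G.degree v : ℝ) = Real.sqrt (G.degree v) ^ 2 := (Real.sq_sqrt (by positivity)).symm
    rw [hp, mul_pow, h2, ← mul_assoc, ← mul_pow, Real.sqrt_sq h.le, mul_inv_cancel₀ h.ne']
    ring
  have h1 : ∑ v, ∑ w ∈ G.neighborFinset v, p v * p w ≤ ∑ v, x v ^ 2 := by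
    calc ∑ v, ∑ w ∈ G.neighborFinset v, p v * p w
        ≤ ∑ v, ∑ w ∈ G.neighborFinset v, (p v ^ 2 / 2 + p w ^ 2 / 2) :=
          Finset.sum_le_sum fun v _ => Finset.sum_le_sum fun w _ => by
            nlinarith [sq_nonneg (p v - p w)]
      _ = ∑ v, (G.degree v : ℝ) * (p v ^ 2 / 2) + ∑ v, (G.degree v : ℝ) * (p v ^ 2 / 2) := by
          simp only [Finset.sum_add_distrib]
          rw [sum_sum_neighborFinset]
          simp
      _ = ∑ v, x v ^ 2 := by
          rw [← Finset.sum_add_distrib]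
          exact Finset.sum_congr rfl fun v _ => by rw [← hpd v]; ring
  have h2 : x ⬝ᵥ (sysMatrix G α).mulVec x =
      (1 + α) / 2 * ∑ v, x v ^ 2 - (1 - α) / 2 * ∑ v, ∑ w ∈ G.neighborFinset v, p v * p w := by
    simp only [dotProduct, sysMatrix_mulVec_apply, Finset.mul_sum, ← Finset.sum_sub_distrib]
    refine Finset.sum_congr rfl fun v _ => ?_
    rw [mul_sub, Finset.mul_sum]
    congr 1
    · ring
    · exact Finset.sum_congr rfl fun w _ => by simp only [hp]; ring
  rw [h2]
  nlinarith [mul_le_mul_of_nonneg_left h1 (by linarith : 0 ≤ (1 - α) / 2)]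

theorem isUnit_det_sysMatrix (hd : ∀ v, 0 < G.degree v) (hα0 : 0 < α) (hα1 : α ≤ 1) :
    IsUnit (sysMatrix G α).det := by
  rw [← Matrix.isUnit_iff_isUnit_det, ← Matrix.mulVec_injective_iff_isUnit]
  intro x y hxy
  have h0 : (sysMatrix G α).mulVec (x - y) = 0 := by
    rw [Matrix.mulVec_sub]
    exact sub_eq_zero.2 hxy
  have h := mul_dotProduct_self_le hd hα1 (x - y)
  rw [h0, dotProduct_zero] at h
  have h2 : ∑ v, (x - y) v ^ 2 = 0 :=
    le_antisymm (nonpos_of_mul_nonpos_right h hα0) (Finset.sum_nonneg fun _ _ => sq_nonneg _)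
  rw [Finset.sum_eq_zero_iff_of_nonneg fun _ _ => sq_nonneg _] at h2
  funext v
  exact sub_eq_zero.1 (pow_eq_zero_iff two_ne_zero |>.1 (h2 v (Finset.mem_univ v)))

theorem sysMatrix_mulVec_optSolution (hd : ∀ v, 0 < G.degree v) (hα0 : 0 < α) (hα1 : α ≤ 1) :
    (sysMatrix G α).mulVec (optSolution G α b) = α • (invSqrtDeg G).mulVec b := by
  rw [optSolution, Matrix.mulVec_smul, Matrix.mulVec_mulVec,
    Matrix.mul_nonsing_inv _ (isUnit_det_sysMatrix hd hα0 hα1), Matrix.one_mulVec]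

theorem gradObjective_eq (hd : ∀ v, 0 < G.degree v) (hα0 : 0 < α) (hα1 : α ≤ 1) (x : V → ℝ) :
    gradObjective G α b x = (sysMatrix G α).mulVec (x - optSolution G α b) := by
  rw [Matrix.mulVec_sub, sysMatrix_mulVec_optSolution hd hα0 hα1, gradObjective]

theorem objective_eq (hd : ∀ v, 0 < G.degree v) (hα0 : 0 < α) (hα1 : α ≤ 1) (z : V → ℝ) :
    objective G α b z = objective G α b (optSolution G α b) + 1 / 2 *
      ((z - optSolution G α b) ⬝ᵥ (sysMatrix G α).mulVec (z - optSolution G α b)) := by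
  -- With `η = 0` the exact expansion is that of `f`; its linear term vanishes because the gradient
  -- at `x*` is `Q (x* - x*)`.
  have h := proxObjective_add G α b 0 0 (optSolution G α b) (z - optSolution G α b)
  simpa [proxObjective, gradProx, gradObjective_eq hd hα0 hα1] using h

theorem objective_ge (hd : ∀ v, 0 < G.degree v) (hα0 : 0 < α) (hα1 : α ≤ 1) (z : V → ℝ) :
    objective G α b (optSolution G α b) + α / 2 * ∑ v, (z v - optSolution G α b v) ^ 2 ≤
      objective G α b z := by
  rw [objective_eq hd hα0 hα1 z]
  have h := mul_dotProduct_self_le hd hα1 (z - optSolution G α b)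
  simp only [Pi.sub_apply] at h
  linarith

theorem objective_lt (hd : ∀ v, 0 < G.degree v) (hα0 : 0 < α) (hα1 : α ≤ 1) {z : V → ℝ}
    (hz : z ≠ optSolution G α b) :
    objective G α b (optSolution G α b) < objective G α b z := by
  refine lt_of_lt_of_le ?_ (objective_ge hd hα0 hα1 z)
  obtain ⟨v, hv⟩ := Function.ne_iff.1 hz
  have : 0 < ∑ v, (z v - optSolution G α b v) ^ 2 :=
    Finset.sum_pos' (fun _ _ => sq_nonneg _)
      ⟨v, Finset.mem_univ v, by have := sub_ne_zero.2 hv; positivity⟩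
  have : 0 < α / 2 * ∑ v, (z v - optSolution G α b v) ^ 2 := by positivity
  linarith

/-- A scaled maximum-norm bound on the gradient bounds the scaled maximum-norm error. -/
theorem error_le_of_stopTest [Nonempty V] (hd : ∀ v, 0 < G.degree v) (hα0 : 0 < α) (hα1 : α ≤ 1)
    {ε : ℝ} {x : V → ℝ} (h : StopTest G α b ε x) (v : V) :
    |x v - optSolution G α b v| / Real.sqrt (G.degree v) ≤ ε := by
  set p : V → ℝ := fun v => (Real.sqrt (G.degree v))⁻¹ * (x v - optSolution G α b v) with hp
  -- Maximum principle: where `|p|` is largest, the neighbour sum is at most `d_u |p_u|`, so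
  -- diagonal dominance leaves the factor `(1+α)/2 - (1-α)/2 = α`.
  obtain ⟨u, -, hu⟩ := Finset.exists_max_image Finset.univ (fun v => |p v|) Finset.univ_nonempty
  have hs := sqrt_degree_pos hd u
  have hpu : x u - optSolution G α b u = Real.sqrt (G.degree u) * p u := by
    rw [hp, mul_inv_cancel_left₀ hs.ne']
  have h1 : |∑ w ∈ G.neighborFinset u, p w| ≤ G.degree u * |p u| := by
    calc |∑ w ∈ G.neighborFinset u, p w| ≤ ∑ w ∈ G.neighborFinset u, |p w| :=
          Finset.abs_sum_le_sum_abs _ _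
      _ ≤ ∑ w ∈ G.neighborFinset u, |p u| :=
          Finset.sum_le_sum fun w _ => hu w (Finset.mem_univ w)
      _ = G.degree u * |p u| := by simp
  have h2 : Real.sqrt (G.degree u) * gradObjective G α b x u =
      G.degree u * ((1 + α) / 2 * p u) - (1 - α) / 2 * ∑ w ∈ G.neighborFinset u, p w := by
    rw [gradObjective_eq hd hα0 hα1, sysMatrix_mulVec_apply, ← Finset.mul_sum]
    simp only [Pi.sub_apply]
    rw [hpu, mul_sub]
    congr 1
    · nth_rewrite 3 [← Real.mul_self_sqrt (Nat.cast_nonneg (G.degree u))]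
      ring
    · rw [mul_left_comm, mul_inv_cancel_left₀ hs.ne']
  have h3 : α * (G.degree u * |p u|) ≤ Real.sqrt (G.degree u) * |gradObjective G α b x u| := by
    rw [sqrt_mul_abs, h2]
    refine le_trans ?_ (abs_sub_abs_le_abs_sub _ _)
    rw [abs_mul _ ((1 + α) / 2 * p u), abs_mul _ (p u), abs_mul _ (∑ w ∈ _, _),
      abs_of_nonneg (by linarith : 0 ≤ (1 + α) / 2),
      abs_of_nonneg (by linarith : 0 ≤ (1 - α) / 2), Nat.abs_cast]
    nlinarith [mul_le_mul_of_nonneg_left h1 (by linarith : 0 ≤ (1 - α) / 2)]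
  have h4 : Real.sqrt (G.degree u) * |gradObjective G α b x u| ≤ ε * α * G.degree u := by
    calc _ ≤ Real.sqrt (G.degree u) * (ε * α * Real.sqrt (G.degree u)) :=
          mul_le_mul_of_nonneg_left (not_le.1 (h u)).le hs.le
      _ = ε * α * (Real.sqrt (G.degree u) * Real.sqrt (G.degree u)) := by ring
      _ = ε * α * G.degree u := by rw [Real.mul_self_sqrt (Nat.cast_nonneg _)]
  have hdu : (0 : ℝ) < G.degree u := by exact_mod_cast hd u
  have h5 : |p u| ≤ ε := by
    have : (α * G.degree u) * |p u| ≤ (α * G.degree u) * ε := by linarith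
    exact le_of_mul_le_mul_left this (by positivity)
  refine le_trans (le_of_eq ?_) ((hu v (Finset.mem_univ v)).trans h5)
  rw [hp, abs_mul, abs_of_pos (inv_pos.2 (sqrt_degree_pos hd v)), div_eq_inv_mul]

/-! ### Decrease of the scaled gradient norm -/

/-- The update of the scaled gradient under a step on `S`. -/
theorem sqrt_mul_gradProx_localStep (hd : ∀ v, 0 < G.degree v) (hη : 0 < 1 + α + 2 * η)
    (S : Finset V) (y z : V → ℝ) (v : V) :
    Real.sqrt (G.degree v) * gradProx G α b η y (localStep G α b η S y z) v =
      (if v ∈ S then 0 else Real.sqrt (G.degree v) * gradProx G α b η y z v) +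
        ∑ w ∈ G.neighborFinset v, if w ∈ S then (1 - tauRate α η) *
          (Real.sqrt (G.degree w) * gradProx G α b η y z w / G.degree w) else 0 := by
  set g := gradProx G α b η y z with hg
  set δ : V → ℝ := fun u => if u ∈ S then -(2 * g u / (1 + α + 2 * η)) else 0 with hδ
  have hz : localStep G α b η S y z = z + δ := by
    funext u
    simp only [localStep, hδ, Pi.add_apply]
    split_ifs <;> ring
  have h1 : gradProx G α b η y (z + δ) v = g v + ((sysMatrix G α).mulVec δ v + η * δ v) := by
    simp only [hg, gradProx, gradObjective, Matrix.mulVec_add, Pi.add_apply, Pi.sub_apply,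
      Pi.smul_apply, smul_eq_mul]
    ring
  have hs := sqrt_degree_pos hd v
  rw [hz, h1, sysMatrix_mulVec_apply, ← Finset.mul_sum, mul_add]
  -- The diagonal part `(1+α+2η)/2` cancels against the step size on `S`; the off-diagonal part
  -- becomes `(1-α)/(1+α+2η) = 1 - τ`.
  have h2 : Real.sqrt (G.degree v) * ((1 + α) / 2 * δ v - (1 - α) / 2 *
      ((Real.sqrt (G.degree v))⁻¹ * ∑ w ∈ G.neighborFinset v, (Real.sqrt (G.degree w))⁻¹ * δ w) +
      η * δ v) = Real.sqrt (G.degree v) * ((1 + α + 2 * η) / 2 * δ v) +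
        ∑ w ∈ G.neighborFinset v, -((1 - α) / 2) * ((Real.sqrt (G.degree w))⁻¹ * δ w) := by
    rw [← Finset.mul_sum]
    field_simp
    ring
  rw [h2, ← add_assoc]
  congr 1
  · simp only [hδ]
    split_ifs
    · field_simp
      ring
    · ring
  · refine Finset.sum_congr rfl fun w _ => ?_
    simp only [hδ]
    split_ifs
    · have hsw := sqrt_degree_pos hd w
      nth_rewrite 3 [← Real.mul_self_sqrt (Nat.cast_nonneg (G.degree w))]
      rw [tauRate]
      field_simp
      ring
    · ring

theorem tauRate_pos (hα0 : 0 < α) (hη : 0 ≤ η) : 0 < tauRate α η := by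
  unfold tauRate
  positivity

theorem tauRate_le_one (hα0 : 0 < α) (hα1 : α ≤ 1) (hη : 0 ≤ η) : tauRate α η ≤ 1 := by
  rw [tauRate, div_le_one (by positivity)]
  linarith

/-- A step on `S` decreases a weighted `ℓ¹`-norm of the scaled gradient, for weights at most `1`. -/
theorem weighted_scaledGradNorm_localStep_le (hd : ∀ v, 0 < G.degree v) (hα0 : 0 < α)
    (hα1 : α ≤ 1) (hη : 0 ≤ η) (c : V → ℝ) (hc0 : ∀ v, 0 ≤ c v) (hc1 : ∀ v, c v ≤ 1)
    (S : Finset V) (y z : V → ℝ) :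
    ∑ v, c v * (Real.sqrt (G.degree v) * |gradProx G α b η y (localStep G α b η S y z) v|) ≤
      ∑ v, (if v ∈ S then 1 - tauRate α η else c v) *
        (Real.sqrt (G.degree v) * |gradProx G α b η y z v|) := by
  set r : V → ℝ := fun v => Real.sqrt (G.degree v) * gradProx G α b η y z v with hr
  have habs (v : V) : Real.sqrt (G.degree v) * |gradProx G α b η y z v| = |r v| :=
    sqrt_mul_abs _ _
  have hθ : 0 ≤ 1 - tauRate α η := sub_nonneg.2 (tauRate_le_one hα0 hα1 hη)
  set F : V → ℝ := fun w => if w ∈ S then (1 - tauRate α η) * (|r w| / G.degree w) else 0 with hF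
  have hF0 (w : V) : 0 ≤ F w := by
    simp only [hF]
    split_ifs
    · positivity
    · exact le_rfl
  -- The weight is kept on the old mass, while mass arriving from neighbours is counted with weight
  -- `1`. Each `w ∈ S` sends `(1-τ)|r_w|/d_w` to `d_w` neighbours, hence `(1-τ)|r_w|` in total.
  have hstep (v : V) :
      c v * (Real.sqrt (G.degree v) * |gradProx G α b η y (localStep G α b η S y z) v|) ≤
        (if v ∈ S then 0 else c v * |r v|) + ∑ w ∈ G.neighborFinset v, F w := by
    have h1 : Real.sqrt (G.degree v) * |gradProx G α b η y (localStep G α b η S y z) v| ≤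
        (if v ∈ S then 0 else |r v|) + ∑ w ∈ G.neighborFinset v, F w := by
      rw [sqrt_mul_abs, sqrt_mul_gradProx_localStep hd (by positivity)]
      refine (abs_add_le _ _).trans (add_le_add ?_ ((Finset.abs_sum_le_sum_abs _ _).trans
        (Finset.sum_le_sum fun w _ => ?_)))
      · split_ifs <;> simp [hr]
      · simp only [hF]
        split_ifs
        · rw [abs_mul, abs_of_nonneg hθ, abs_div, Nat.abs_cast]
        · simp
    have hN : 0 ≤ ∑ w ∈ G.neighborFinset v, F w := Finset.sum_nonneg fun w _ => hF0 w
    calc _ ≤ c v * ((if v ∈ S then 0 else |r v|) + ∑ w ∈ G.neighborFinset v, F w) :=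
          mul_le_mul_of_nonneg_left h1 (hc0 v)
      _ = (if v ∈ S then 0 else c v * |r v|) + c v * ∑ w ∈ G.neighborFinset v, F w := by
          split_ifs <;> ring
      _ ≤ _ := by linarith [mul_le_mul_of_nonneg_right (hc1 v) hN]
  refine (Finset.sum_le_sum fun v _ => hstep v).trans (le_of_eq ?_)
  rw [Finset.sum_add_distrib, sum_sum_neighborFinset, ← Finset.sum_add_distrib]
  refine Finset.sum_congr rfl fun v _ => ?_
  have hdv : (G.degree v : ℝ) ≠ 0 := by exact_mod_cast (hd v).ne'
  simp only [hF, habs]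
  split_ifs
  · field_simp
    ring
  · ring

theorem scaledGradNorm_nonneg (y z : V → ℝ) : 0 ≤ scaledGradNorm G α b η y z :=
  Finset.sum_nonneg fun _ _ => by positivity

theorem sum_ite_mul (S : Finset V) (t : ℝ) (F : V → ℝ) :
    ∑ v, (if v ∈ S then 1 - t else 1) * F v = ∑ v, F v - t * ∑ v ∈ S, F v := by
  rw [← Finset.sum_ite_mem_eq S F, Finset.mul_sum, ← Finset.sum_sub_distrib]
  exact Finset.sum_congr rfl fun v _ => by split_ifs <;> ring

theorem scaledGradNorm_localStep_le (hd : ∀ v, 0 < G.degree v) (hα0 : 0 < α)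
    (hα1 : α ≤ 1) (hη : 0 ≤ η) (S : Finset V) (y z : V → ℝ) :
    scaledGradNorm G α b η y (localStep G α b η S y z) ≤ scaledGradNorm G α b η y z -
      tauRate α η * ∑ v ∈ S, Real.sqrt (G.degree v) * |gradProx G α b η y z v| := by
  have h := weighted_scaledGradNorm_localStep_le (b := b) hd hα0 hα1 hη (fun _ => 1)
    (fun _ => zero_le_one) (fun _ => le_rfl) S y z
  rw [sum_ite_mul] at h
  simpa [scaledGradNorm] using h

/-- Processing the nodes of a list one by one: the decrease is measured by the gradient at the
starting point, whatever the cancellations on the way. -/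
theorem scaledGradNorm_foldl_le (hd : ∀ v, 0 < G.degree v) (hα0 : 0 < α)
    (hα1 : α ≤ 1) (hη : 0 ≤ η) (y : V → ℝ) (l : List V) (hl : l.Nodup) (z : V → ℝ) :
    scaledGradNorm G α b η y (l.foldl (fun w u => localStep G α b η {u} y w) z) ≤
      ∑ v, (if v ∈ l.toFinset then 1 - tauRate α η else 1) *
        (Real.sqrt (G.degree v) * |gradProx G α b η y z v|) := by
  induction l generalizing z with
  | nil => simp [scaledGradNorm]
  | cons u l ih =>
    rw [List.nodup_cons] at hl
    have hτ := tauRate_le_one hα0 hα1 hη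
    have hτ0 := tauRate_pos hα0 hη
    -- The induction hypothesis has weight `1 - τ` on the tail and `1` elsewhere, evaluated after
    -- the update at `u`. The weighted one-step estimate moves back before that update, changing
    -- only the weight at `u` to `1 - τ`.
    refine (ih hl.2 _).trans ((weighted_scaledGradNorm_localStep_le hd hα0 hα1 hη _ ?_ ?_
      {u} y z).trans (le_of_eq ?_))
    · intro v
      split_ifs <;> linarith
    · intro v
      split_ifs <;> linarith
    · refine Finset.sum_congr rfl fun v _ => ?_
      congr 1
      by_cases hv : v = u
      · simp [hv]
      · simp [hv]

theorem scaledGradNorm_innerRound_le (hd : ∀ v, 0 < G.degree v) (hα0 : 0 < α)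
    (hα1 : α ≤ 1) (hη : 0 ≤ η) (M : LocalSolver V) (t k : ℕ) (S : Finset V) (y z : V → ℝ) :
    scaledGradNorm G α b η y (innerRound G α b η M t k S y z) ≤ scaledGradNorm G α b η y z -
      tauRate α η * ∑ v ∈ S, Real.sqrt (G.degree v) * |gradProx G α b η y z v| := by
  cases M with
  | locGD => exact scaledGradNorm_localStep_le hd hα0 hα1 hη S y z
  | locAPPR σ =>
    have h := scaledGradNorm_foldl_le (b := b) hd hα0 hα1 hη y (σ.list t k S) (σ.nodup t k S) z
    have hS : (σ.list t k S).toFinset = S := by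
      ext v
      rw [List.mem_toFinset, σ.mem_iff]
    rw [hS, sum_ite_mul] at h
    exact h

/-- The inequality `u ≤ -log (1 - u)` for the relative decrease; it turns gradient ratios into
logarithms that telescope. -/
theorem mul_div_le_log_div {t x A B : ℝ} (hB : 0 < B) (hAB : B ≤ A - t * x) (hA : 0 < A) :
    t * (x / A) ≤ Real.log (A / B) := by
  have h := Real.log_le_sub_one_of_pos (div_pos hB hA)
  rw [← inv_div A B, Real.log_inv] at h
  have h2 : B / A ≤ 1 - t * (x / A) := by
    rw [div_le_iff₀ hA]
    field_simp
    linarith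
  rw [inv_div] at h
  linarith

/-- The logarithmic decreases of the single-node steps add up. Positivity is needed only at the end,
because the norm never increases along the steps. -/
theorem sequentialRatio_le_log (hd : ∀ v, 0 < G.degree v) (hα0 : 0 < α)
    (hα1 : α ≤ 1) (hη : 0 ≤ η) (y : V → ℝ) (l : List V) (z : V → ℝ)
    (h0 : 0 < scaledGradNorm G α b η y (l.foldl (fun w u => localStep G α b η {u} y w) z)) :
    0 < scaledGradNorm G α b η y z ∧ tauRate α η * sequentialRatio G α b η y l z ≤
      Real.log (scaledGradNorm G α b η y z /
        scaledGradNorm G α b η y (l.foldl (fun w u => localStep G α b η {u} y w) z)) := by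
  induction l generalizing z with
  | nil => exact ⟨h0, by simp [sequentialRatio]⟩
  | cons u l ih =>
    rw [List.foldl_cons] at h0 ⊢
    obtain ⟨h1, h2⟩ := ih _ h0
    have h3 := scaledGradNorm_localStep_le (b := b) hd hα0 hα1 hη {u} y z
    rw [Finset.sum_singleton] at h3
    have hx : 0 ≤ tauRate α η * (Real.sqrt (G.degree u) * |gradProx G α b η y z u|) :=
      mul_nonneg (tauRate_pos hα0 hη).le (by positivity)
    have hA : 0 < scaledGradNorm G α b η y z := by linarith
    refine ⟨hA, ?_⟩
    have h4 := mul_div_le_log_div h1 h3 hA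
    rw [sequentialRatio, mul_add]
    have h5 := add_le_add h4 h2
    rwa [← Real.log_mul (div_pos hA h1).ne' (div_pos h1 h0).ne', div_mul_div_cancel₀ h1.ne'] at h5

theorem sequentialRatio_nonneg (y : V → ℝ) (l : List V) (z : V → ℝ) :
    0 ≤ sequentialRatio G α b η y l z := by
  induction l generalizing z with
  | nil => exact le_rfl
  | cons u l ih =>
    exact add_nonneg (div_nonneg (by positivity) (scaledGradNorm_nonneg _ _)) (ih _)

end LocalPPR

namespace LocalPPR

variable {V : Type*} [Fintype V] {G : SimpleGraph V} [DecidableRel G.Adj]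

theorem vol_nonneg (S : Finset V) : 0 ≤ vol G S :=
  Finset.sum_nonneg fun _ _ => Nat.cast_nonneg _

theorem vol_pos (hd : ∀ v, 0 < G.degree v) {S : Finset V} (hS : S.Nonempty) : 0 < vol G S :=
  Finset.sum_pos (fun v _ => by exact_mod_cast hd v) hS

theorem one_le_vol (hd : ∀ v, 0 < G.degree v) {S : Finset V} (hS : S.Nonempty) :
    1 ≤ vol G S := by
  obtain ⟨v, hv⟩ := hS
  calc (1 : ℝ) ≤ G.degree v := by exact_mod_cast hd v
    _ ≤ vol G S := Finset.single_le_sum (f := fun v => (G.degree v : ℝ))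
      (fun _ _ => Nat.cast_nonneg _) hv

variable [DecidableEq V] {α : ℝ} {b : V → ℝ} {η : ℝ}

/-! ### The work of a stage -/

/-- The first entry of the maximum suffices; the second is `0` by the division convention when the
initial gradient norm vanishes. -/
theorem innerTol_pos (hαη : 0 < α + η) (hm : 0 < G.edgeFinset.card) {φ : ℝ} (hφ : 0 < φ)
    (y : V → ℝ) : 0 < innerTol G α b η φ y :=
  lt_max_of_lt_left (Real.sqrt_pos.2 (by positivity))

theorem mem_stageSet {M : LocalSolver V} {t k : ℕ} {u : V} :
    u ∈ stageSet G α b η M t k ↔ stageTol G α b η M t * Real.sqrt (G.degree u) ≤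
      |gradProx G α b η (stageCentre G α b η M t) (stageIter G α b η M t k) u| := by
  simp [stageSet, activeSet]

theorem tol_mul_vol_le (M : LocalSolver V) (t k : ℕ) :
    stageTol G α b η M t * vol G (stageSet G α b η M t k) ≤
      ∑ v ∈ stageSet G α b η M t k, Real.sqrt (G.degree v) *
        |gradProx G α b η (stageCentre G α b η M t) (stageIter G α b η M t k) v| := by
  rw [vol, Finset.mul_sum]
  refine Finset.sum_le_sum fun v hv => ?_
  calc stageTol G α b η M t * (G.degree v : ℝ)
      = Real.sqrt (G.degree v) * (stageTol G α b η M t * Real.sqrt (G.degree v)) := by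
        nth_rewrite 1 [← Real.mul_self_sqrt (Nat.cast_nonneg (G.degree v))]
        ring
    _ ≤ _ := mul_le_mul_of_nonneg_left (mem_stageSet.1 hv) (Real.sqrt_nonneg _)

theorem stageNorm_nonneg (M : LocalSolver V) (t k : ℕ) : 0 ≤ stageNorm G α b η M t k :=
  scaledGradNorm_nonneg _ _

section Decrease

variable (hd : ∀ v, 0 < G.degree v) (hα0 : 0 < α) (hα1 : α ≤ 1) (hη : 0 ≤ η)
  (M : LocalSolver V) (t : ℕ)
include hd hα0 hα1 hη

theorem stageNorm_succ_le (k : ℕ) :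
    stageNorm G α b η M t (k + 1) ≤ stageNorm G α b η M t k - tauRate α η *
      ∑ v ∈ stageSet G α b η M t k, Real.sqrt (G.degree v) *
        |gradProx G α b η (stageCentre G α b η M t) (stageIter G α b η M t k) v| :=
  scaledGradNorm_innerRound_le hd hα0 hα1 hη M t k _ _ _

theorem stageNorm_antitone : Antitone (stageNorm G α b η M t) :=
  antitone_nat_of_succ_le fun k => (stageNorm_succ_le hd hα0 hα1 hη M t k).trans
    (sub_le_self _ (mul_nonneg (tauRate_pos hα0 hη).le
      (Finset.sum_nonneg fun _ _ => by positivity)))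

theorem tauRate_mul_tol_mul_vol_le (k : ℕ) :
    tauRate α η * stageTol G α b η M t * vol G (stageSet G α b η M t k) ≤
      stageNorm G α b η M t k - stageNorm G α b η M t (k + 1) := by
  have h := stageNorm_succ_le (b := b) hd hα0 hα1 hη M t k
  have h2 := mul_le_mul_of_nonneg_left (tol_mul_vol_le (G := G) (α := α) (b := b) (η := η) M t k)
    (tauRate_pos hα0 hη).le
  rw [mul_assoc]
  linarith

theorem tauRate_mul_tol_mul_sum_vol_le (n : ℕ) :
    tauRate α η * stageTol G α b η M t * ∑ k ∈ Finset.range n, vol G (stageSet G α b η M t k) ≤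
      stageNorm G α b η M t 0 - stageNorm G α b η M t n := by
  rw [Finset.mul_sum, ← Finset.sum_range_sub' (stageNorm G α b η M t)]
  exact Finset.sum_le_sum fun k _ => tauRate_mul_tol_mul_vol_le hd hα0 hα1 hη M t k

variable (ht : 0 < stageTol G α b η M t)
include ht

/-- Every nonempty round has volume at least `1`, while the total volume is at most `C⁰ / (τ ε_t)`.
-/
theorem exists_stageSet_eq_empty : ∃ k, stageSet G α b η M t k = ∅ := by
  by_contra! hne
  have hτ := mul_pos (tauRate_pos hα0 hη) ht
  obtain ⟨n, hn⟩ := exists_nat_gt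
    (stageNorm G α b η M t 0 / (tauRate α η * stageTol G α b η M t))
  rw [div_lt_iff₀ hτ] at hn
  have h := tauRate_mul_tol_mul_sum_vol_le (b := b) hd hα0 hα1 hη M t n
  have h1 : (n : ℝ) ≤ ∑ k ∈ Finset.range n, vol G (stageSet G α b η M t k) := by
    calc (n : ℝ) = ∑ k ∈ Finset.range n, (1 : ℝ) := by simp
      _ ≤ _ := Finset.sum_le_sum fun k _ => one_le_vol hd (hne k)
  have h2 := mul_le_mul_of_nonneg_left h1 hτ.le
  have h3 := stageNorm_nonneg (G := G) (α := α) (b := b) (η := η) M t n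
  linarith

/-- Termination matters here: the infimum of an empty set of naturals would be `0`, not an exit
time. -/
theorem stageSet_stageCount : stageSet G α b η M t (stageCount G α b η M t) = ∅ :=
  Nat.sInf_mem (s := {k | stageSet G α b η M t k = ∅})
    (exists_stageSet_eq_empty hd hα0 hα1 hη M t ht)

omit hd hα0 hα1 hη ht in
theorem stageSet_nonempty {k : ℕ} (hk : k < stageCount G α b η M t) :
    (stageSet G α b η M t k).Nonempty :=
  Finset.nonempty_iff_ne_empty.2
    (Nat.notMem_of_lt_sInf (s := {k | stageSet G α b η M t k = ∅}) hk)

omit hα0 hα1 hη in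
theorem activeSum_pos {k : ℕ} (hk : k < stageCount G α b η M t) :
    0 < ∑ v ∈ stageSet G α b η M t k, Real.sqrt (G.degree v) *
      |gradProx G α b η (stageCentre G α b η M t) (stageIter G α b η M t k) v| :=
  (mul_pos ht (vol_pos hd (stageSet_nonempty M t hk))).trans_le (tol_mul_vol_le M t k)

omit hα0 hα1 hη in
theorem stageNorm_pos {k : ℕ} (hk : k < stageCount G α b η M t) :
    0 < stageNorm G α b η M t k :=
  (activeSum_pos hd M t ht hk).trans_le (Finset.sum_le_sum_of_subset_of_nonneg
    (Finset.subset_univ _) fun _ _ _ => by positivity)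

omit hα0 hα1 hη in
theorem gradRatio_pos {k : ℕ} (hk : k < stageCount G α b η M t) :
    0 < gradRatio G α b η M t k :=
  div_pos (activeSum_pos hd M t ht hk) (stageNorm_pos hd M t ht hk)

theorem tauRate_mul_gradRatio_le {k : ℕ} (hk : k < stageCount G α b η M t)
    (h0 : 0 < stageNorm G α b η M t (k + 1)) : tauRate α η * gradRatio G α b η M t k ≤
      Real.log (stageNorm G α b η M t k / stageNorm G α b η M t (k + 1)) :=
  mul_div_le_log_div h0 (stageNorm_succ_le hd hα0 hα1 hη M t k) (stageNorm_pos hd M t ht hk)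

omit hα0 hα1 hη in
theorem updateRatio_pos {k : ℕ} (hk : k < stageCount G α b η M t) :
    0 < updateRatio G α b η M t k := by
  cases M with
  | locGD => exact gradRatio_pos hd _ t ht hk
  | locAPPR σ =>
    obtain ⟨v, hv⟩ := stageSet_nonempty _ t hk
    have hC := stageNorm_pos hd _ t ht hk
    have hmem := (σ.mem_iff t k (stageSet G α b η (.locAPPR σ) t k))
    simp only [updateRatio]
    -- Earlier updates may cancel the gradient at later nodes, but the first processed node is still
    -- active, and one positive term is enough.
    cases hl : σ.list t k (stageSet G α b η (.locAPPR σ) t k) with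
    | nil =>
      rw [← hmem, hl] at hv
      simp at hv
    | cons u l =>
      have hu : u ∈ stageSet G α b η (.locAPPR σ) t k := by
        rw [← hmem, hl]
        exact List.mem_cons_self
      have hs := sqrt_degree_pos hd u
      have hg := (mul_pos ht hs).trans_le (mem_stageSet.1 hu)
      exact add_pos_of_pos_of_nonneg (div_pos (mul_pos hs hg) hC) (sequentialRatio_nonneg _ _ _)

theorem tauRate_mul_updateRatio_le {k : ℕ} (hk : k < stageCount G α b η M t)
    (h0 : 0 < stageNorm G α b η M t (k + 1)) : tauRate α η * updateRatio G α b η M t k ≤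
      Real.log (stageNorm G α b η M t k / stageNorm G α b η M t (k + 1)) := by
  cases M with
  | locGD => exact tauRate_mul_gradRatio_le hd hα0 hα1 hη _ t ht hk h0
  | locAPPR σ => exact (sequentialRatio_le_log hd hα0 hα1 hη _ _ _ h0).2

/-- Stated for arbitrary per-round ratios `γ`, to cover both averages. The factors `1/K` cancel in
`v̄ / γ̄`, leaving work over `∑ γ`, and `τ ∑ γ ≤ log (C⁰/C^K)` by telescoping. -/
theorem stageWork_le_stageBound (γ : ℕ → ℝ) (hγ : ∀ k < stageCount G α b η M t, 0 < γ k)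
    (hlog : ∀ k < stageCount G α b η M t, 0 < stageNorm G α b η M t (k + 1) →
      tauRate α η * γ k ≤
        Real.log (stageNorm G α b η M t k / stageNorm G α b η M t (k + 1))) :
    stageWork G α b η M t ≤ stageBound G α b η M
      (1 / (stageCount G α b η M t : ℝ) * ∑ k ∈ Finset.range (stageCount G α b η M t), γ k) t := by
  have hτ := tauRate_pos hα0 hη
  have hanti := stageNorm_antitone (b := b) hd hα0 hα1 hη M t
  have h2 : stageWork G α b η M t ≤
      (stageNorm G α b η M t 0 - stageNorm G α b η M t (stageCount G α b η M t)) /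
        (tauRate α η * stageTol G α b η M t) := by
    rw [le_div_iff₀' (mul_pos hτ ht)]
    exact tauRate_mul_tol_mul_sum_vol_le hd hα0 hα1 hη M t _
  simp only [stageBound]
  split_ifs with hC
  · exact h2
  refine le_min ?_ h2
  set K := stageCount G α b η M t with hK
  have hCK : 0 < stageNorm G α b η M t K := lt_of_le_of_ne (stageNorm_nonneg M t K) (Ne.symm hC)
  have hpos (k : ℕ) (hk : k ≤ K) : 0 < stageNorm G α b η M t k := hCK.trans_le (hanti hk)
  rcases Nat.eq_zero_or_pos K with h0 | h0
  · simp [stageWork, avgVol, ← hK, h0]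
  have hsum : 0 < ∑ k ∈ Finset.range K, γ k :=
    Finset.sum_pos (fun k hk => hγ k (Finset.mem_range.1 hk)) ⟨0, Finset.mem_range.2 h0⟩
  have htel : tauRate α η * ∑ k ∈ Finset.range K, γ k ≤
      Real.log (stageNorm G α b η M t 0 / stageNorm G α b η M t K) := by
    rw [Real.log_div (hpos 0 (Nat.zero_le _)).ne' hCK.ne',
      ← Finset.sum_range_sub' (fun k => Real.log (stageNorm G α b η M t k)), Finset.mul_sum]
    refine Finset.sum_le_sum fun k hk => ?_
    have hk := Finset.mem_range.1 hk
    rw [← Real.log_div (hpos k hk.le).ne' (hpos (k + 1) hk).ne']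
    exact hlog k hk (hpos (k + 1) hk)
  have hKr : (0 : ℝ) < K := by exact_mod_cast h0
  have hW : 0 ≤ stageWork G α b η M t := Finset.sum_nonneg fun _ _ => vol_nonneg _
  have hrw : avgVol G α b η M t / (tauRate α η * (1 / (K : ℝ) * ∑ k ∈ Finset.range K, γ k)) =
      stageWork G α b η M t / (tauRate α η * ∑ k ∈ Finset.range K, γ k) := by
    simp only [avgVol, stageWork, ← hK]
    field_simp
  rw [hrw, div_mul_eq_mul_div, le_div_iff₀ (mul_pos hτ hsum)]
  exact mul_le_mul_of_nonneg_left htel hW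

omit hα0 hα1 hη in
-- Mass per unit volume is at least `ε_t` on the active set and at most `ε_t` off it, so the active
-- share of the mass is at least the active share `vol(S) / 2m` of the volume.
theorem vol_le_two_mul_card_mul_gradRatio {k : ℕ} (hk : k < stageCount G α b η M t) :
    vol G (stageSet G α b η M t k) ≤ 2 * (G.edgeFinset.card : ℝ) * gradRatio G α b η M t k := by
  set S := stageSet G α b η M t k with hS
  set r : V → ℝ := fun v => Real.sqrt (G.degree v) *
    |gradProx G α b η (stageCentre G α b η M t) (stageIter G α b η M t k) v| with hr
  have hm : 2 * (G.edgeFinset.card : ℝ) = vol G S + vol G Sᶜ := by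
    rw [vol, vol, Finset.sum_add_sum_compl]
    exact_mod_cast (SimpleGraph.sum_degrees_eq_twice_card_edges G).symm
  have hC : stageNorm G α b η M t k = ∑ v ∈ S, r v + ∑ v ∈ Sᶜ, r v :=
    (Finset.sum_add_sum_compl _ _).symm
  have hout : ∑ v ∈ Sᶜ, r v ≤ stageTol G α b η M t * vol G Sᶜ := by
    rw [vol, Finset.mul_sum]
    refine Finset.sum_le_sum fun v hv => ?_
    rw [Finset.mem_compl, hS, mem_stageSet, not_le] at hv
    calc r v ≤ Real.sqrt (G.degree v) * (stageTol G α b η M t * Real.sqrt (G.degree v)) :=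
          mul_le_mul_of_nonneg_left hv.le (Real.sqrt_nonneg _)
      _ = stageTol G α b η M t * (Real.sqrt (G.degree v) * Real.sqrt (G.degree v)) := by ring
      _ = _ := by rw [Real.mul_self_sqrt (Nat.cast_nonneg _)]
  have hin : stageTol G α b η M t * vol G S ≤ ∑ v ∈ S, r v := tol_mul_vol_le M t k
  have hCpos := stageNorm_pos hd M t ht hk
  have hg : gradRatio G α b η M t k = (∑ v ∈ S, r v) / stageNorm G α b η M t k := rfl
  rw [hg, ← mul_div_assoc, le_div_iff₀ hCpos, hC, hm]
  nlinarith [mul_le_mul_of_nonneg_left hout (vol_nonneg (G := G) S),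
    mul_le_mul_of_nonneg_right hin (vol_nonneg (G := G) Sᶜ)]

theorem vol_le_norm_div_tol_mul_gradRatio {k : ℕ} (hk : k < stageCount G α b η M t) :
    vol G (stageSet G α b η M t k) ≤
      stageNorm G α b η M t 0 / stageTol G α b η M t * gradRatio G α b η M t k := by
  have hC := stageNorm_pos hd M t ht hk
  have h0 : stageNorm G α b η M t k ≤ stageNorm G α b η M t 0 :=
    stageNorm_antitone hd hα0 hα1 hη M t (Nat.zero_le k)
  have hg := (gradRatio_pos hd M t ht hk).le
  have h1 : stageTol G α b η M t * vol G (stageSet G α b η M t k) ≤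
      gradRatio G α b η M t k * stageNorm G α b η M t k := by
    rw [gradRatio, div_mul_cancel₀ _ hC.ne']
    exact tol_mul_vol_le M t k
  rw [div_mul_eq_mul_div, le_div_iff₀' ht]
  nlinarith [mul_le_mul_of_nonneg_left h0 hg]

theorem avgVol_div_avgRatio_le :
    avgVol G α b η M t / avgRatio G α b η M t ≤
      min (stageNorm G α b η M t 0 / stageTol G α b η M t) (2 * (G.edgeFinset.card : ℝ)) := by
  set K := stageCount G α b η M t with hK
  have hB : 0 ≤ stageNorm G α b η M t 0 / stageTol G α b η M t :=
    div_nonneg (stageNorm_nonneg M t 0) ht.le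
  rcases Nat.eq_zero_or_pos K with h0 | h0
  · simp [avgVol, ← hK, h0, hB]
  have hKr : (0 : ℝ) < 1 / K := by positivity
  have hsum : 0 < avgRatio G α b η M t := mul_pos hKr (Finset.sum_pos
    (fun k hk => gradRatio_pos hd M t ht (Finset.mem_range.1 hk)) ⟨0, Finset.mem_range.2 h0⟩)
  -- A common bound on the quotients of individual rounds passes to the quotient of the averages.
  have key (B : ℝ) (h : ∀ k < K, vol G (stageSet G α b η M t k) ≤ B * gradRatio G α b η M t k) :
      avgVol G α b η M t / avgRatio G α b η M t ≤ B := by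
    rw [div_le_iff₀ hsum, avgVol, avgRatio, mul_left_comm, Finset.mul_sum (a := B)]
    exact mul_le_mul_of_nonneg_left
      (Finset.sum_le_sum fun k hk => h k (Finset.mem_range.1 hk)) hKr.le
  exact le_min (key _ fun k hk => vol_le_norm_div_tol_mul_gradRatio hd hα0 hα1 hη M t ht hk)
    (key _ fun k hk => vol_le_two_mul_card_mul_gradRatio hd M t ht hk)

/-- The output of stage `t` has a gradient small enough for the target precision. -/
theorem sum_sq_gradProx_le {φ : ℝ} (hφ : 0 ≤ φ) (hm : 0 < G.edgeFinset.card)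
    (htol : stageTol G α b η M t = innerTol G α b η φ (stageCentre G α b η M t)) :
    ∑ v, gradProx G α b η (stageCentre G α b η M t)
      (stageIter G α b η M t (stageCount G α b η M t)) v ^ 2 ≤ 2 * (α + η) * φ := by
  set g := gradProx G α b η (stageCentre G α b η M t)
    (stageIter G α b η M t (stageCount G α b η M t)) with hg
  set e := stageTol G α b η M t with he
  have hsmall (v : V) : |g v| ≤ e * Real.sqrt (G.degree v) := by
    have h : v ∉ stageSet G α b η M t (stageCount G α b η M t) := by
      rw [stageSet_stageCount hd hα0 hα1 hη M t ht]
      exact Finset.notMem_empty v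
    rw [mem_stageSet, not_le] at h
    exact h.le
  have hmr : (0 : ℝ) < G.edgeFinset.card := by exact_mod_cast hm
  have hc : 0 < α + η := by linarith
  -- Each entry of the maximum fits one estimate. For the first, squaring `|g_v| ≤ e √d_v` and
  -- summing gives `2m e²`. For the second, `g_v² ≤ e √d_v |g_v|` sums to at most `e C^K ≤ e C⁰`.
  rcases max_choice (Real.sqrt ((α + η) * φ / (G.edgeFinset.card : ℝ)))
    (2 * (η + α) * φ / scaledGradNorm G α b η (stageCentre G α b η M t)
      (stageCentre G α b η M t)) with h | h
  · rw [innerTol, h] at htol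
    have he2 : e ^ 2 = (α + η) * φ / G.edgeFinset.card := by
      rw [htol, Real.sq_sqrt (by positivity)]
    calc ∑ v, g v ^ 2 ≤ ∑ v, e ^ 2 * (G.degree v : ℝ) := by
          refine Finset.sum_le_sum fun v _ => ?_
          have h1 := pow_le_pow_left₀ (abs_nonneg _) (hsmall v) 2
          rwa [sq_abs, mul_pow, Real.sq_sqrt (Nat.cast_nonneg _)] at h1
      _ = e ^ 2 * (2 * G.edgeFinset.card) := by
          rw [← Finset.mul_sum]
          congr 1
          exact_mod_cast SimpleGraph.sum_degrees_eq_twice_card_edges G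
      _ = _ := by
          rw [he2]
          field_simp
  · rw [innerTol, h] at htol
    have hC0 : scaledGradNorm G α b η (stageCentre G α b η M t) (stageCentre G α b η M t) ≠ 0 := by
      intro h0
      rw [h0, div_zero] at htol
      exact ht.ne' htol
    have hCK : ∑ v, Real.sqrt (G.degree v) * |g v| ≤
        scaledGradNorm G α b η (stageCentre G α b η M t) (stageCentre G α b η M t) := by
      have h1 := stageNorm_antitone (b := b) hd hα0 hα1 hη M t
        (Nat.zero_le (stageCount G α b η M t))
      simp only [stageNorm, stageIter, innerIter] at h1
      exact h1
    calc ∑ v, g v ^ 2 ≤ ∑ v, e * (Real.sqrt (G.degree v) * |g v|) := by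
          refine Finset.sum_le_sum fun v _ => ?_
          have h1 := mul_le_mul_of_nonneg_right (hsmall v) (abs_nonneg (g v))
          rw [← sq_abs]
          linarith
      _ ≤ e * scaledGradNorm G α b η (stageCentre G α b η M t) (stageCentre G α b η M t) := by
          rw [← Finset.mul_sum]
          exact mul_le_mul_of_nonneg_left hCK ht.le
      _ = _ := by
          rw [htol, div_mul_cancel₀ _ hC0]
          ring

end Decrease

end LocalPPR

namespace LocalPPR

variable {V : Type*} [Fintype V] {α : ℝ} {b : V → ℝ} {η : ℝ}

/-! ### Parameters of the outer loop -/

theorem momentum_eq (hα0 : 0 < α) (hη : 0 ≤ η) :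
    momentum α η = (1 - Real.sqrt (qRatio α η)) / (1 + Real.sqrt (qRatio α η)) := by
  have hc : 0 < Real.sqrt (α + η) := Real.sqrt_pos.2 (by linarith)
  have ha : 0 ≤ Real.sqrt α := Real.sqrt_nonneg _
  rw [momentum, qRatio, Real.sqrt_div hα0.le]
  field_simp

theorem qRatio_pos (hα0 : 0 < α) (hη : 0 ≤ η) : 0 < qRatio α η :=
  div_pos hα0 (by linarith)

theorem sqrt_qRatio_lt_one (hα0 : 0 < α) (hη : 0 < η) : Real.sqrt (qRatio α η) < 1 := by
  rw [Real.sqrt_lt' one_pos, one_pow, qRatio, div_lt_one (by linarith)]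
  linarith

theorem rhoRate_pos (hα0 : 0 < α) (hη : 0 ≤ η) : 0 < rhoRate α η :=
  mul_pos (by norm_num) (Real.sqrt_pos.2 (qRatio_pos hα0 hη))

theorem rhoRate_lt (hα0 : 0 < α) (hη : 0 ≤ η) : rhoRate α η < Real.sqrt (qRatio α η) := by
  have := Real.sqrt_pos.2 (qRatio_pos hα0 hη)
  rw [rhoRate]
  linarith

theorem outerTol_pos (hα0 : 0 < α) (hη : 0 < η) (hb : 0 < norm1 b) (t : ℕ) :
    0 < outerTol α b η t := by
  have h : 0 < 1 - rhoRate α η := by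
    linarith [rhoRate_lt hα0 hη.le, sqrt_qRatio_lt_one hα0 hη]
  rw [outerTol]
  positivity

end LocalPPR

namespace LocalPPR

variable {V : Type*} [Fintype V] {G : SimpleGraph V} [DecidableRel G.Adj]
variable [DecidableEq V] {α : ℝ} {b : V → ℝ} {η : ℝ}

/-! ### Convergence of the outer loop -/

theorem proxObjective_add_ge (hd : ∀ v, 0 < G.degree v) (hα1 : α ≤ 1) (y x z : V → ℝ) :
    objective G α b x + ∑ i, gradProx G α b η y x i * (z i - x i) +
        (α + η) / 2 * ∑ i, (z i - x i) ^ 2 + η / 2 * ∑ i, (x i - y i) ^ 2 ≤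
      objective G α b z + η / 2 * ∑ i, (z i - y i) ^ 2 := by
  have h := proxObjective_add G α b η y x (z - x)
  rw [add_sub_cancel] at h
  simp only [proxObjective, dotProduct, Pi.sub_apply] at h
  have h2 := mul_dotProduct_self_le hd hα1 (z - x)
  simp only [dotProduct, Pi.sub_apply] at h2
  linarith

/-- On the segment to `x*` the gap `f - f*` scales exactly by `(1-s)² = (1-s) - s(1-s)`; the surplus
`s(1-s)` is converted by `Q ≥ α`. -/
theorem objective_convexComb_le (hd : ∀ v, 0 < G.degree v) (hα0 : 0 < α) (hα1 : α ≤ 1)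
    {s : ℝ} (hs0 : 0 ≤ s) (hs1 : s ≤ 1) (x : V → ℝ) :
    objective G α b (s • optSolution G α b + (1 - s) • x) ≤
      s * objective G α b (optSolution G α b) + (1 - s) * objective G α b x -
        α / 2 * (s * (1 - s)) * ∑ i, (x i - optSolution G α b i) ^ 2 := by
  have hz : s • optSolution G α b + (1 - s) • x - optSolution G α b =
      (1 - s) • (x - optSolution G α b) := by
    funext i
    simp only [Pi.add_apply, Pi.sub_apply, Pi.smul_apply, smul_eq_mul]
    ring
  rw [objective_eq hd hα0 hα1 (_ + _), objective_eq hd hα0 hα1 x, hz, Matrix.mulVec_smul,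
    smul_dotProduct, dotProduct_smul, smul_eq_mul, smul_eq_mul]
  have h := mul_dotProduct_self_le hd hα1 (x - optSolution G α b)
  simp only [Pi.sub_apply] at h
  have h2 := mul_le_mul_of_nonneg_left h (mul_nonneg hs0 (sub_nonneg.2 hs1))
  linarith

variable (G α b) in
/-- The Lyapunov function `f(x) - f(x*) + (α/2) ‖v - x*‖²` of the accelerated outer loop. -/
noncomputable def potential (x v : V → ℝ) : ℝ :=
  objective G α b x - objective G α b (optSolution G α b) +
    α / 2 * ∑ i, (v i - optSolution G α b i) ^ 2

theorem le_potential (hd : ∀ v, 0 < G.degree v) (hα0 : 0 < α) (hα1 : α ≤ 1) (x v : V → ℝ) :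
    α / 2 * ∑ i, (v i - optSolution G α b i) ^ 2 ≤ potential G α b x v := by
  have h := objective_ge (b := b) hd hα0 hα1 x
  have h2 : 0 ≤ α / 2 * ∑ i, (x i - optSolution G α b i) ^ 2 :=
    mul_nonneg (by linarith) (Finset.sum_nonneg fun _ _ => sq_nonneg _)
  rw [potential]
  linarith

theorem potential_nonneg (hd : ∀ v, 0 < G.degree v) (hα0 : 0 < α) (hα1 : α ≤ 1) (x v : V → ℝ) :
    0 ≤ potential G α b x v :=
  (mul_nonneg (by linarith) (Finset.sum_nonneg fun _ _ => sq_nonneg _)).trans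
    (le_potential hd hα0 hα1 x v)

/-- Here `s = √q`. Strong convexity of `h` compares `x₁` with `z = s x* + (1-s) x₀`. Since `z - x₁ =
-s (v₁ - x*)` and `s²(α+η) = α`, its quadratic term is exactly the new distance term of the
potential. The proximal term at `z` is paid for by the old distance term and the convexity surplus
at `x₀`; the inexactness survives as the inner product. -/
theorem potential_step_le (hd : ∀ v, 0 < G.degree v) (hα0 : 0 < α) (hα1 : α ≤ 1) {s : ℝ}
    (hs0 : 0 < s) (hs1 : s ≤ 1) (hsα : α = s ^ 2 * (α + η)) (hη : 0 ≤ η)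
    {x₀ v₀ y x₁ v₁ : V → ℝ}
    (hy : ∀ i, y i = x₀ i + s / (1 + s) * (v₀ i - x₀ i))
    (hv : ∀ i, s * v₁ i = s * x₀ i + (x₁ i - x₀ i)) :
    potential G α b x₁ v₁ ≤ (1 - s) * potential G α b x₀ v₀ +
      s * ∑ i, gradProx G α b η y x₁ i * (v₁ i - optSolution G α b i) := by
  set xs := optSolution G α b with hxs
  set z : V → ℝ := s • xs + (1 - s) • x₀ with hz
  have hzi (i : V) : z i = s * xs i + (1 - s) * x₀ i := by simp [hz]
  have hzx (i : V) : z i - x₁ i = -(s * (v₁ i - xs i)) := by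
    rw [hzi]
    linarith [hv i]
  have h1 := proxObjective_add_ge (b := b) (η := η) hd hα1 y x₁ z
  have h2 := objective_convexComb_le (b := b) hd hα0 hα1 hs0.le hs1 x₀
  rw [← hxs, ← hz] at h2
  have hc : 0 ≤ α + η := by linarith
  have hηs : η = (α + η) * ((1 - s) * (1 + s)) := by linarith
  have h3 : η / 2 * ∑ i, (z i - y i) ^ 2 ≤ α * (1 - s) / 2 *
      (s * ∑ i, (x₀ i - xs i) ^ 2 + ∑ i, (v₀ i - xs i) ^ 2) := by
    rw [Finset.mul_sum, Finset.mul_sum, ← Finset.sum_add_distrib, Finset.mul_sum]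
    refine Finset.sum_le_sum fun i _ => ?_
    have hzy : z i - y i = -(s / (1 + s)) * (s * (x₀ i - xs i) + (v₀ i - xs i)) := by
      rw [hzi, hy]
      field_simp
      ring
    -- Convexity of the square with weights `s/(1+s)` and `1/(1+s)`; the defect is `s (x₀ - v₀)²`.
    have hconv : (s * (x₀ i - xs i) + (v₀ i - xs i)) ^ 2 ≤
        (1 + s) * (s * (x₀ i - xs i) ^ 2 + (v₀ i - xs i) ^ 2) := by
      nlinarith [mul_nonneg hs0.le (sq_nonneg (x₀ i - v₀ i))]
    have hk : 0 ≤ (α + η) * s ^ 2 * (1 - s) / (2 * (1 + s)) :=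
      div_nonneg (mul_nonneg (mul_nonneg hc (sq_nonneg s)) (by linarith)) (by linarith)
    calc η / 2 * (z i - y i) ^ 2
        = (α + η) * s ^ 2 * (1 - s) / (2 * (1 + s)) *
            (s * (x₀ i - xs i) + (v₀ i - xs i)) ^ 2 := by
          rw [hzy]
          nth_rewrite 1 [hηs]
          field_simp
      _ ≤ (α + η) * s ^ 2 * (1 - s) / (2 * (1 + s)) *
            ((1 + s) * (s * (x₀ i - xs i) ^ 2 + (v₀ i - xs i) ^ 2)) :=
          mul_le_mul_of_nonneg_left hconv hk
      _ = (s ^ 2 * (α + η)) * (1 - s) / 2 *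
            (s * (x₀ i - xs i) ^ 2 + (v₀ i - xs i) ^ 2) := by
          field_simp
      _ = _ := by rw [← hsα]
  have h4 : ∑ i, gradProx G α b η y x₁ i * (z i - x₁ i) =
      -(s * ∑ i, gradProx G α b η y x₁ i * (v₁ i - xs i)) := by
    rw [Finset.mul_sum, ← Finset.sum_neg_distrib]
    exact Finset.sum_congr rfl fun i _ => by rw [hzx]; ring
  have h5 : (α + η) / 2 * ∑ i, (z i - x₁ i) ^ 2 = α / 2 * ∑ i, (v₁ i - xs i) ^ 2 := by
    nth_rewrite 2 [hsα]
    rw [Finset.mul_sum, Finset.mul_sum]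
    exact Finset.sum_congr rfl fun i _ => by rw [hzx]; ring
  have h6 : 0 ≤ η / 2 * ∑ i, (x₁ i - y i) ^ 2 :=
    mul_nonneg (by linarith) (Finset.sum_nonneg fun _ _ => sq_nonneg _)
  simp only [potential, ← hxs]
  linarith

/-- By Cauchy–Schwarz and `s²(α+η) = α` the error term is at most `2 √φ √E₁`. The resulting
quadratic inequality in `√E₁` gives a recursion that is linear in the square roots. -/
theorem sqrt_potential_step_le (hd : ∀ v, 0 < G.degree v) (hα0 : 0 < α) (hα1 : α ≤ 1) {s : ℝ}
    (hs0 : 0 < s) (hs1 : s ≤ 1) (hsα : α = s ^ 2 * (α + η)) (hη : 0 ≤ η)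
    {x₀ v₀ y x₁ v₁ : V → ℝ} {φ : ℝ} (hφ : 0 ≤ φ)
    (hy : ∀ i, y i = x₀ i + s / (1 + s) * (v₀ i - x₀ i))
    (hv : ∀ i, s * v₁ i = s * x₀ i + (x₁ i - x₀ i))
    (hg : ∑ i, gradProx G α b η y x₁ i ^ 2 ≤ 2 * (α + η) * φ) :
    Real.sqrt (potential G α b x₁ v₁) ≤
      Real.sqrt (1 - s) * Real.sqrt (potential G α b x₀ v₀) + 2 * Real.sqrt φ := by
  have hE0 := potential_nonneg (b := b) hd hα0 hα1 x₀ v₀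
  have hE1 := potential_nonneg (b := b) hd hα0 hα1 x₁ v₁
  have hstep := potential_step_le (b := b) hd hα0 hα1 hs0 hs1 hsα hη hy hv
  set U := ∑ i, (v₁ i - optSolution G α b i) ^ 2 with hU
  set I := ∑ i, gradProx G α b η y x₁ i * (v₁ i - optSolution G α b i) with hI
  have hU0 : 0 ≤ U := Finset.sum_nonneg fun _ _ => sq_nonneg _
  have hcs : I ^ 2 ≤ 2 * (α + η) * φ * U :=
    (Finset.sum_mul_sq_le_sq_mul_sq _ _ _).trans (mul_le_mul_of_nonneg_right hg hU0)
  have hle : α / 2 * U ≤ potential G α b x₁ v₁ := le_potential hd hα0 hα1 x₁ v₁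
  have hsI : s * I ≤ 2 * Real.sqrt φ * Real.sqrt (potential G α b x₁ v₁) := by
    refine le_of_sq_le_sq ?_ (by positivity)
    rw [mul_pow, mul_pow, mul_pow, Real.sq_sqrt hφ, Real.sq_sqrt hE1]
    calc s ^ 2 * I ^ 2 ≤ s ^ 2 * (2 * (α + η) * φ * U) :=
          mul_le_mul_of_nonneg_left hcs (sq_nonneg s)
      _ = 2 * (s ^ 2 * (α + η)) * φ * U := by ring
      _ = 4 * φ * (α / 2 * U) := by rw [← hsα]; ring
      _ ≤ 2 ^ 2 * φ * potential G α b x₁ v₁ := by nlinarith [mul_le_mul_of_nonneg_left hle hφ]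
  have e0 := Real.sq_sqrt hE0
  have e1 := Real.sq_sqrt hE1
  have ea := Real.sq_sqrt (sub_nonneg.2 hs1)
  set E0 := Real.sqrt (potential G α b x₀ v₀)
  set E1 := Real.sqrt (potential G α b x₁ v₁)
  set a := Real.sqrt (1 - s)
  set p := Real.sqrt φ
  have ha0 : 0 ≤ a * E0 := by positivity
  have hp0 : 0 ≤ p := Real.sqrt_nonneg _
  by_contra! hlt
  have h1 : (a * E0) * (a * E0) < E1 * (E1 - 2 * p) :=
    mul_lt_mul'' (by linarith) (by linarith) ha0 ha0
  rw [← e0, ← e1, ← ea] at hstep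
  nlinarith

theorem sum_sq_invSqrtDeg_mulVec_le (hd : ∀ v, 0 < G.degree v) :
    ∑ v, (invSqrtDeg G).mulVec b v ^ 2 ≤ norm1 b ^ 2 := by
  calc ∑ v, (invSqrtDeg G).mulVec b v ^ 2 ≤ ∑ v, |b v| ^ 2 := by
        refine Finset.sum_le_sum fun v _ => ?_
        rw [invSqrtDeg, Matrix.mulVec_diagonal, mul_pow, inv_pow,
          Real.sq_sqrt (Nat.cast_nonneg _), sq_abs]
        have : (1 : ℝ) ≤ G.degree v := by exact_mod_cast hd v
        exact mul_le_of_le_one_left (sq_nonneg _) (inv_le_one_of_one_le₀ this)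
    _ ≤ norm1 b ^ 2 := Finset.sum_sq_le_sq_sum_of_nonneg fun _ _ => abs_nonneg _

/-- Testing `Q x* = α β` with `x*` gives `‖x*‖² ≤ ⟨x*, β⟩`; Young's inequality then bounds both by
`‖β‖² ≤ ‖b‖₁²`. -/
theorem potential_zero_le (hd : ∀ v, 0 < G.degree v) (hα0 : 0 < α) (hα1 : α ≤ 1) :
    potential G α b 0 0 ≤ α * norm1 b ^ 2 := by
  set xs := optSolution G α b with hxs
  set β := (invSqrtDeg G).mulVec b with hβ
  have hdot : xs ⬝ᵥ (sysMatrix G α).mulVec xs = α * ∑ v, xs v * β v := by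
    rw [sysMatrix_mulVec_optSolution hd hα0 hα1, dotProduct_smul, smul_eq_mul]
    rfl
  have h0 : objective G α b 0 - objective G α b xs = 1 / 2 * (α * ∑ v, xs v * β v) := by
    rw [objective_eq hd hα0 hα1 0, ← hxs, zero_sub, Matrix.mulVec_neg, neg_dotProduct_neg, hdot]
    ring
  have h1 : ∑ v, xs v ^ 2 ≤ ∑ v, xs v * β v := by
    have h := mul_dotProduct_self_le hd hα1 xs
    rw [hdot] at h
    exact le_of_mul_le_mul_left h hα0
  have h2 : ∑ v, xs v * β v ≤ 1 / 2 * ∑ v, xs v ^ 2 + 1 / 2 * ∑ v, β v ^ 2 := by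
    rw [Finset.mul_sum, Finset.mul_sum, ← Finset.sum_add_distrib]
    exact Finset.sum_le_sum fun v _ => by nlinarith [sq_nonneg (xs v - β v)]
  have h3 : ∑ v, β v ^ 2 ≤ norm1 b ^ 2 := sum_sq_invSqrtDeg_mulVec_le hd
  have h4 : potential G α b 0 0 = 1 / 2 * (α * ∑ v, xs v * β v) + α / 2 * ∑ v, xs v ^ 2 := by
    rw [potential, ← hxs, h0]
    simp
  rw [h4]
  nlinarith

theorem stageTol_pos (hα0 : 0 < α) (hη : 0 < η) (hb : 0 < norm1 b)
    (hm : 0 < G.edgeFinset.card) (M : LocalSolver V) (t : ℕ) : 0 < stageTol G α b η M t :=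
  innerTol_pos (by linarith) hm (outerTol_pos hα0 hη hb t) _

variable (G α b η) in
/-- The estimate-sequence point `x + (1 + 1/√q) (y - x)` of the outer state `(x, y)`. -/
noncomputable def auxPoint (M : LocalSolver V) (t : ℕ) : V → ℝ := fun i =>
  (outerState G α b η M t).1 i + (1 + Real.sqrt (qRatio α η)) / Real.sqrt (qRatio α η) *
    ((outerState G α b η M t).2 i - (outerState G α b η M t).1 i)

/-! ### Geometric decay along the outer iterates -/

section Outer

variable (hd : ∀ v, 0 < G.degree v) (hα0 : 0 < α) (hα1 : α ≤ 1) (hη : 0 < η)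
  (hb : 0 < norm1 b) (hm : 0 < G.edgeFinset.card) (M : LocalSolver V)
include hd hα0 hα1 hη hb hm

theorem sqrt_potential_outerState_succ_le (t : ℕ) :
    Real.sqrt (potential G α b (outerState G α b η M (t + 1)).1 (auxPoint G α b η M (t + 1))) ≤
      Real.sqrt (1 - Real.sqrt (qRatio α η)) *
        Real.sqrt (potential G α b (outerState G α b η M t).1 (auxPoint G α b η M t)) +
      2 * Real.sqrt (outerTol α b η (t + 1)) := by
  have hs0 := Real.sqrt_pos.2 (qRatio_pos hα0 hη.le)
  have hs1 := sqrt_qRatio_lt_one hα0 hη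
  have hsq : α = Real.sqrt (qRatio α η) ^ 2 * (α + η) := by
    rw [Real.sq_sqrt (qRatio_pos hα0 hη.le).le, qRatio, div_mul_cancel₀ _ (by linarith)]
  have hφ := outerTol_pos hα0 hη hb (t + 1)
  refine sqrt_potential_step_le (y := (outerState G α b η M t).2) hd hα0 hα1 hs0 hs1.le hsq hη.le
    hφ.le ?_ ?_ ?_
  · intro i
    simp only [auxPoint]
    field_simp
    ring
  · intro i
    have h2 : (outerState G α b η M (t + 1)).2 i = (outerState G α b η M (t + 1)).1 i +
        momentum α η * ((outerState G α b η M (t + 1)).1 i - (outerState G α b η M t).1 i) := rfl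
    -- With `s = √q`, the momentum weight `(1-s)/(1+s)` makes `v₁ = x₁ + ((1-s)/s)(x₁ - x₀)`, the
    -- required relation.
    simp only [auxPoint, h2, momentum_eq hα0 hη.le]
    field_simp
    ring
  · exact sum_sq_gradProx_le hd hα0 hα1 hη.le M (t + 1)
      (stageTol_pos hα0 hη hb hm M (t + 1)) hφ.le hm rfl

/-- The recursion `e_{t+1} ≤ a e_t + c r^{t+1}` with `a < r` preserves the bound `c r^{t+1}/(r-a)`;
`a < r` is the condition `ρ < √q`. -/
theorem sqrt_potential_outerState_le (t : ℕ) :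
    Real.sqrt (potential G α b (outerState G α b η M t).1 (auxPoint G α b η M t)) ≤
      Real.sqrt ((1 + α) / 2) * norm1 b * (Real.sqrt (1 - rhoRate α η) ^ (t + 1) /
        (Real.sqrt (1 - rhoRate α η) - Real.sqrt (1 - Real.sqrt (qRatio α η)))) := by
  have hρs := rhoRate_lt hα0 hη.le
  have hs1 := sqrt_qRatio_lt_one hα0 hη
  have hstep := sqrt_potential_outerState_succ_le hd hα0 hα1 hη hb hm M
  have hra : Real.sqrt (1 - Real.sqrt (qRatio α η)) < Real.sqrt (1 - rhoRate α η) :=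
    Real.sqrt_lt_sqrt (by linarith) (by linarith)
  have ha0 : 0 ≤ Real.sqrt (1 - Real.sqrt (qRatio α η)) := Real.sqrt_nonneg _
  have hr2 : Real.sqrt (1 - rhoRate α η) ^ 2 = 1 - rhoRate α η := Real.sq_sqrt (by linarith)
  have hB2 : Real.sqrt ((1 + α) / 2) ^ 2 = (1 + α) / 2 := Real.sq_sqrt (by linarith)
  have hB0 : 0 ≤ Real.sqrt ((1 + α) / 2) := Real.sqrt_nonneg _
  set a := Real.sqrt (1 - Real.sqrt (qRatio α η))
  set r := Real.sqrt (1 - rhoRate α η)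
  set B := Real.sqrt ((1 + α) / 2)
  have hr0 : 0 ≤ r := ha0.trans hra.le
  have hra0 : 0 < r - a := sub_pos.2 hra
  have hBb : 0 ≤ B * norm1 b := mul_nonneg hB0 hb.le
  induction t with
  | zero =>
    have h0 : auxPoint G α b η M 0 = 0 := by
      funext i
      simp [auxPoint, outerState]
    have h1 : Real.sqrt (potential G α b 0 0) ≤ B * norm1 b := by
      rw [Real.sqrt_le_left hBb, mul_pow, hB2]
      refine (potential_zero_le hd hα0 hα1).trans ?_
      exact mul_le_mul_of_nonneg_right (by linarith) (sq_nonneg _)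
    have h2 : 1 ≤ r ^ (0 + 1) / (r - a) := by
      rw [le_div_iff₀ hra0, zero_add, pow_one]
      linarith
    rw [h0]
    exact h1.trans (le_mul_of_one_le_right hBb h2)
  | succ t ih =>
    have hφ : 2 * Real.sqrt (outerTol α b η (t + 1)) ≤ B * norm1 b * r ^ (t + 1) := by
      have hX : 0 ≤ B * norm1 b * r ^ (t + 1) := by positivity
      -- The constant `18 = 2 · 3²` in `φ_t` makes the forcing term `2/3` of what the recursion can
      -- absorb.
      have h1 : Real.sqrt (outerTol α b η (t + 1)) = B * norm1 b * r ^ (t + 1) / 3 := by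
        rw [Real.sqrt_eq_iff_eq_sq (outerTol_pos hα0 hη hb _).le (by positivity), div_pow,
          mul_pow, mul_pow, hB2, ← pow_mul, mul_comm (t + 1) 2, pow_mul, hr2, outerTol]
        ring
      rw [h1]
      linarith
    calc _ ≤ a * (B * norm1 b * (r ^ (t + 1) / (r - a))) + B * norm1 b * r ^ (t + 1) :=
          (hstep t).trans (add_le_add (mul_le_mul_of_nonneg_left ih ha0) hφ)
      _ = B * norm1 b * (r ^ (t + 1 + 1) / (r - a)) := by
          field_simp
          ring

theorem objective_outerState_sub_le (t : ℕ) :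
    objective G α b (outerState G α b η M t).1 - objective G α b (optSolution G α b) ≤
      2 * (1 + α) * norm1 b ^ 2 / (Real.sqrt (qRatio α η) - rhoRate α η) ^ 2 *
        (1 - rhoRate α η) ^ (t + 1) := by
  have hρs := rhoRate_lt hα0 hη.le
  have hρ0 := rhoRate_pos hα0 hη.le
  have hs1 := sqrt_qRatio_lt_one hα0 hη
  have h := sqrt_potential_outerState_le hd hα0 hα1 hη hb hm M t
  have hr2 : Real.sqrt (1 - rhoRate α η) ^ 2 = 1 - rhoRate α η := Real.sq_sqrt (by linarith)
  have ha2 : Real.sqrt (1 - Real.sqrt (qRatio α η)) ^ 2 = 1 - Real.sqrt (qRatio α η) :=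
    Real.sq_sqrt (by linarith)
  have hB2 : Real.sqrt ((1 + α) / 2) ^ 2 = (1 + α) / 2 := Real.sq_sqrt (by linarith)
  have ha0 : 0 ≤ Real.sqrt (1 - Real.sqrt (qRatio α η)) := Real.sqrt_nonneg _
  have hra : Real.sqrt (1 - Real.sqrt (qRatio α η)) < Real.sqrt (1 - rhoRate α η) :=
    Real.sqrt_lt_sqrt (by linarith) (by linarith)
  have hr1 : Real.sqrt (1 - rhoRate α η) ≤ 1 := Real.sqrt_le_one.2 (by linarith)
  have hP0 := potential_nonneg (b := b) hd hα0 hα1 (outerState G α b η M t).1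
    (auxPoint G α b η M t)
  have hsq := pow_le_pow_left₀ (Real.sqrt_nonneg _) h 2
  rw [Real.sq_sqrt hP0, mul_pow, mul_pow, hB2, div_pow, ← pow_mul, mul_comm (t + 1) 2, pow_mul,
    hr2] at hsq
  have hgap : 0 ≤ α / 2 * ∑ i, (auxPoint G α b η M t i - optSolution G α b i) ^ 2 :=
    mul_nonneg (by linarith) (Finset.sum_nonneg fun _ _ => sq_nonneg _)
  have hle : objective G α b (outerState G α b η M t).1 - objective G α b (optSolution G α b) ≤
      potential G α b (outerState G α b η M t).1 (auxPoint G α b η M t) := by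
    rw [potential]
    linarith
  refine (hle.trans hsq).trans ?_
  set s := Real.sqrt (qRatio α η)
  set a := Real.sqrt (1 - s)
  set r := Real.sqrt (1 - rhoRate α η)
  -- `(r - a)(r + a) = s - ρ` and `r + a ≤ 2`.
  have hdiff : (s - rhoRate α η) / 2 ≤ r - a := by nlinarith
  have hdiff2 : (s - rhoRate α η) ^ 2 / 4 ≤ (r - a) ^ 2 := by nlinarith
  have hsρ : 0 < s - rhoRate α η := by linarith
  have hpow : 0 ≤ (1 - rhoRate α η) ^ (t + 1) := pow_nonneg (by linarith) _
  calc (1 + α) / 2 * norm1 b ^ 2 * ((1 - rhoRate α η) ^ (t + 1) / (r - a) ^ 2)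
      ≤ (1 + α) / 2 * norm1 b ^ 2 *
          ((1 - rhoRate α η) ^ (t + 1) / ((s - rhoRate α η) ^ 2 / 4)) := by
        gcongr
    _ = _ := by
        field_simp
        ring

/-- After the prescribed number of iterations the iterate has the required accuracy. -/
theorem error_outerBudget_le {ε : ℝ} (hε : 0 < ε) (v : V) :
    |(outerState G α b η M (outerBudget α b η ε)).1 v - optSolution G α b v| /
      Real.sqrt (G.degree v) ≤ ε := by
  have hρs := rhoRate_lt hα0 hη.le
  have hρ0 := rhoRate_pos hα0 hη.le
  have hs1 := sqrt_qRatio_lt_one hα0 hη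
  set T := outerBudget α b η ε with hT
  set x := (outerState G α b η M T).1 with hx
  have h1 := objective_outerState_sub_le hd hα0 hα1 hη hb hm M T
  have h2 := objective_ge (b := b) hd hα0 hα1 x
  set d := (Real.sqrt (qRatio α η) - rhoRate α η) ^ 2 with hdd
  have hd0 : 0 < d := by
    have : 0 < Real.sqrt (qRatio α η) - rhoRate α η := by linarith
    positivity
  set X := 4 * (1 + α) * norm1 b ^ 2 / (α * ε ^ 2 * d) with hX
  have hX0 : 0 < X := by positivity
  -- Rounding the budget down loses less than one iteration, which the exponent `T + 1` in the decay
  -- estimate recovers.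
  have hlog : Real.log X ≤ rhoRate α η * (T + 1 : ℕ) := by
    have h : 1 / rhoRate α η * Real.log X ≤ (T : ℝ) + 1 := (Nat.lt_floor_add_one _).le
    rw [one_div_mul_eq_div, div_le_iff₀' hρ0] at h
    push_cast
    exact h
  have hpow : (1 - rhoRate α η) ^ (T + 1) ≤ X⁻¹ := by
    calc (1 - rhoRate α η) ^ (T + 1) ≤ Real.exp (-rhoRate α η) ^ (T + 1) :=
          pow_le_pow_left₀ (by linarith) (Real.one_sub_le_exp_neg _) _
      _ = Real.exp (-(rhoRate α η * (T + 1 : ℕ))) := by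
          rw [← Real.exp_nat_mul]
          congr 1
          ring
      _ ≤ Real.exp (-Real.log X) := Real.exp_le_exp.2 (neg_le_neg hlog)
      _ = X⁻¹ := by rw [Real.exp_neg, Real.exp_log hX0]
  have h3 : 2 * (1 + α) * norm1 b ^ 2 / d * (1 - rhoRate α η) ^ (T + 1) ≤ α / 2 * ε ^ 2 := by
    calc _ ≤ 2 * (1 + α) * norm1 b ^ 2 / d * X⁻¹ :=
          mul_le_mul_of_nonneg_left hpow (by positivity)
      _ = _ := by
          rw [hX]
          field_simp
          ring
  have h4 : ∑ i, (x i - optSolution G α b i) ^ 2 ≤ ε ^ 2 :=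
    le_of_mul_le_mul_left (by linarith) (half_pos hα0)
  have h5 : |x v - optSolution G α b v| ≤ ε := by
    refine abs_le_of_sq_le_sq ?_ hε.le
    exact (Finset.single_le_sum (f := fun i => (x i - optSolution G α b i) ^ 2)
      (fun _ _ => sq_nonneg _) (Finset.mem_univ v)).trans h4
  have hdv : 1 ≤ Real.sqrt (G.degree v) := by
    rw [Real.one_le_sqrt]
    exact_mod_cast hd v
  exact (div_le_self (abs_nonneg _) hdv).trans h5

end Outer

end LocalPPR

namespace LocalPPR

variable {V : Type*} [Fintype V] {α : ℝ} {b : V → ℝ} {η : ℝ}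

/-! ### The number of outer iterations -/

/-- `√q - ρ = √q / 10`, the source of the factor `100`. -/
theorem outerBudget_arg_eq (ε : ℝ) (hα0 : 0 < α) (hη : 0 ≤ η) :
    4 * (1 + α) * norm1 b ^ 2 /
      (α * ε ^ 2 * (Real.sqrt (qRatio α η) - rhoRate α η) ^ 2) =
    400 * (1 + α) * norm1 b ^ 2 / (α * ε ^ 2 * qRatio α η) := by
  have h : (Real.sqrt (qRatio α η) - rhoRate α η) ^ 2 = qRatio α η / 100 := by
    have hq := Real.sq_sqrt (qRatio_pos hα0 hη).le
    rw [rhoRate]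
    linarith
  rw [h, ← mul_div_assoc, div_div_eq_mul_div]
  ring

/-- The argument is at least `400 > e`, because `α`, `q` and `ε / ‖b‖₁` are at most `1`. This keeps
the integer part in the budget from being `0`. -/
theorem one_le_log_budget {ε : ℝ} (hε : 0 < ε) (hα0 : 0 < α) (hα1 : α ≤ 1) (hη : 0 < η)
    (hbε : ε ≤ norm1 b) :
    1 ≤ Real.log (400 * (1 + α) * norm1 b ^ 2 / (α * ε ^ 2 * qRatio α η)) := by
  have hq0 := qRatio_pos hα0 hη.le
  have hq1 : qRatio α η ≤ 1 := by
    rw [qRatio, div_le_one (by linarith)]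
    linarith
  have hb0 : 0 < norm1 b := hε.trans_le hbε
  rw [Real.le_log_iff_exp_le (by positivity), le_div_iff₀ (by positivity)]
  have h1 : α * ε ^ 2 * qRatio α η ≤ norm1 b ^ 2 := by
    calc α * ε ^ 2 * qRatio α η ≤ 1 * norm1 b ^ 2 * 1 := by gcongr
      _ = norm1 b ^ 2 := by ring
  have h2 := Real.exp_one_lt_d9
  calc Real.exp 1 * (α * ε ^ 2 * qRatio α η) ≤ 3 * norm1 b ^ 2 :=
        mul_le_mul (by linarith) h1 (by positivity) (by norm_num)
    _ ≤ 400 * (1 + α) * norm1 b ^ 2 :=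
        mul_le_mul_of_nonneg_right (by linarith) (sq_nonneg _)

theorem outerBudget_le {ε : ℝ} (hε : 0 < ε) (hα0 : 0 < α) (hα1 : α ≤ 1) (hη : 0 < η)
    (hbε : ε ≤ norm1 b) :
    (outerBudget α b η ε : ℝ) ≤ 10 / (9 * Real.sqrt (qRatio α η)) *
      Real.log (400 * (1 + α) * norm1 b ^ 2 / (α * ε ^ 2 * qRatio α η)) := by
  have h1 := one_le_log_budget hε hα0 hα1 hη hbε
  have hρ := rhoRate_pos hα0 hη.le
  have hc : 1 / rhoRate α η = 10 / (9 * Real.sqrt (qRatio α η)) := by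
    rw [rhoRate, div_mul_eq_mul_div, one_div_div]
  rw [outerBudget, outerBudget_arg_eq ε hα0 hη.le, ← hc]
  exact Nat.floor_le (by positivity)

theorem one_le_outerBudget {ε : ℝ} (hε : 0 < ε) (hα0 : 0 < α) (hα1 : α ≤ 1) (hη : 0 < η)
    (hbε : ε ≤ norm1 b) : 1 ≤ outerBudget α b η ε := by
  have h1 := one_le_log_budget hε hα0 hα1 hη hbε
  have hρ := rhoRate_pos hα0 hη.le
  have hρ1 : rhoRate α η ≤ 1 := ((rhoRate_lt hα0 hη.le).trans (sqrt_qRatio_lt_one hα0 hη)).le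
  rw [outerBudget, outerBudget_arg_eq ε hα0 hη.le, Nat.one_le_floor_iff]
  exact one_le_mul_of_one_le_of_one_le ((one_le_div hρ).2 hρ1) h1

theorem budget_bound_le {ε : ℝ} (hε : 0 < ε) (hα0 : 0 < α) (hα1 : α < 1)
    (hαη : α + η = 1 - α) (hη : 0 < η) (hbε : ε ≤ norm1 b) :
    10 / (9 * Real.sqrt (qRatio α η)) *
      Real.log (400 * (1 + α) * norm1 b ^ 2 / (α * ε ^ 2 * qRatio α η)) ≤
        20 / 9 * (1 / Real.sqrt α) * Real.log (20 * norm1 b / (α * ε)) := by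
  have hL := one_le_log_budget hε hα0 hα1.le hη hbε
  have hb0 : 0 < norm1 b := hε.trans_le hbε
  have h1α : 0 < 1 - α := by linarith
  have hs0 := Real.sqrt_pos.2 hα0
  have hX : 400 * (1 + α) * norm1 b ^ 2 / (α * ε ^ 2 * qRatio α η) ≤
      (20 * norm1 b / (α * ε)) ^ 2 := by
    -- Substituting `q = α/(1-α)` produces `(1+α)(1-α) = 1 - α² ≤ 1`; the remaining square yields
    -- the factor `2` in front of the logarithm.
    have : 400 * (1 + α) * norm1 b ^ 2 / (α * ε ^ 2 * qRatio α η) =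
        (1 - α ^ 2) * (20 * norm1 b / (α * ε)) ^ 2 := by
      rw [qRatio, hαη]
      field_simp
      ring
    rw [this]
    exact mul_le_of_le_one_left (sq_nonneg _) (by nlinarith)
  have hX0 : 0 < 400 * (1 + α) * norm1 b ^ 2 / (α * ε ^ 2 * qRatio α η) := by
    have := qRatio_pos hα0 hη.le
    positivity
  have hlog := Real.log_le_log hX0 hX
  rw [Real.log_pow] at hlog
  have hc : 10 / (9 * Real.sqrt (qRatio α η)) ≤ 10 / 9 * (1 / Real.sqrt α) := by
    have hle : Real.sqrt α ≤ Real.sqrt (qRatio α η) := by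
      refine Real.sqrt_le_sqrt ?_
      rw [qRatio, hαη, le_div_iff₀ h1α]
      nlinarith
    rw [div_mul_div_comm, mul_one]
    gcongr
  calc _ ≤ 10 / 9 * (1 / Real.sqrt α) * ((2 : ℕ) * Real.log (20 * norm1 b / (α * ε))) :=
        mul_le_mul hc hlog (by linarith) (by positivity)
    _ = _ := by
        push_cast
        ring

variable {G : SimpleGraph V} [DecidableRel G.Adj] [DecidableEq V] {M : LocalSolver V} {ε : ℝ}

theorem outerCount_spec : outerCount G α b η M ε = outerBudget α b η ε ∨
    (1 ≤ outerCount G α b η M ε ∧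
      StopTest G α b ε (outerState G α b η M (outerCount G α b η M ε)).1) :=
  Nat.sInf_mem (s := {t | t = outerBudget α b η ε ∨
    (1 ≤ t ∧ StopTest G α b ε (outerState G α b η M t).1)}) ⟨_, Or.inl rfl⟩

theorem outerCount_le_outerBudget : outerCount G α b η M ε ≤ outerBudget α b η ε :=
  Nat.sInf_le (Or.inl rfl)

end LocalPPR

/-! ### Assembly of the theorem -/

open LocalPPR in
theorem theorem2 {V : Type*} [Fintype V] [DecidableEq V] [Nontrivial V]
    (G : SimpleGraph V) [DecidableRel G.Adj] (hG : G.Connected)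
    (α ε : ℝ) (b : V → ℝ) (hα0 : 0 < α) (hα : α < 1 / 2) (hε : 0 < ε)
    (hb : ∃ i, ε * (G.degree i : ℝ) ≤ |b i|)
    (M : LocalSolver V) (η : ℝ) (hη : η = 1 - 2 * α)
    (N : ℕ) (hN : N = outerCount G α b η M ε) :
    -- `optSolution` is the unique minimizer of the objective
    (∀ z, z ≠ optSolution G α b → objective G α b (optSolution G α b) < objective G α b z) ∧
    -- each of the local solves that are performed ends with an empty active set
    1 ≤ N ∧
    (∀ t ∈ Finset.Icc 1 N, stageSet G α b η M t (stageCount G α b η M t) = ∅) ∧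
    -- accuracy of the returned vector
    (∀ v, |output G α b η M ε v - optSolution G α b v| / Real.sqrt (G.degree v) ≤ ε) ∧
    -- total work
    (∑ t ∈ Finset.Icc 1 N, stageWork G α b η M t ≤
      ∑ t ∈ Finset.Icc 1 N, stageBound G α b η M (avgRatio G α b η M t) t) ∧
    (∑ t ∈ Finset.Icc 1 N, stageWork G α b η M t ≤
      ∑ t ∈ Finset.Icc 1 N, stageBound G α b η M (avgUpdateRatio G α b η M t) t) ∧
    (∀ t ∈ Finset.Icc 1 N, avgVol G α b η M t / avgRatio G α b η M t ≤
      min (stageNorm G α b η M t 0 / stageTol G α b η M t) (2 * (G.edgeFinset.card : ℝ))) ∧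
    -- number of outer iterations
    qRatio α η = α / (1 - α) ∧
    N ≤ outerBudget α b η ε ∧
    (outerBudget α b η ε : ℝ) ≤ 10 / (9 * Real.sqrt (qRatio α η)) *
      Real.log (400 * (1 + α) * norm1 b ^ 2 / (α * ε ^ 2 * qRatio α η)) ∧
    10 / (9 * Real.sqrt (qRatio α η)) *
      Real.log (400 * (1 + α) * norm1 b ^ 2 / (α * ε ^ 2 * qRatio α η)) ≤
        20 / 9 * (1 / Real.sqrt α) * Real.log (20 * norm1 b / (α * ε)) := by
  subst hN
  have hd : ∀ v, 0 < G.degree v := fun v => hG.preconnected.degree_pos_of_nontrivial v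
  have hη0 : 0 < η := by linarith
  have hα1 : α ≤ 1 := by linarith
  -- Nonemptiness of `{i : |b_i| ≥ ε d_i}` enters through this bound: it makes the tolerances
  -- positive and the budget at least `1`.
  have hbε : ε ≤ norm1 b := by
    obtain ⟨i, hi⟩ := hb
    have h1 : (1 : ℝ) ≤ G.degree i := by exact_mod_cast hd i
    calc ε ≤ ε * G.degree i := le_mul_of_one_le_right hε.le h1
      _ ≤ |b i| := hi
      _ ≤ norm1 b :=
        Finset.single_le_sum (f := fun i => |b i|) (fun _ _ => abs_nonneg _) (Finset.mem_univ i)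
  have hb0 : 0 < norm1 b := hε.trans_le hbε
  have hm : 0 < G.edgeFinset.card := by
    obtain ⟨v⟩ := hG.nonempty
    have h1 := G.sum_degrees_eq_twice_card_edges
    have h2 := Finset.single_le_sum (f := fun v => G.degree v) (fun _ _ => Nat.zero_le _)
      (Finset.mem_univ v)
    have h3 := hd v
    omega
  have ht (t : ℕ) : 0 < stageTol G α b η M t := stageTol_pos hα0 hη0 hb0 hm M t
  have hnonempty := hG.nonempty
  refine ⟨fun z hz => objective_lt hd hα0 hα1 hz, ?_,
    fun t _ => stageSet_stageCount hd hα0 hα1 hη0.le M t (ht t), fun v => ?_,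
    Finset.sum_le_sum fun t _ => ?_, Finset.sum_le_sum fun t _ => ?_,
    fun t _ => avgVol_div_avgRatio_le hd hα0 hα1 hη0.le M t (ht t), ?_,
    outerCount_le_outerBudget, outerBudget_le hε hα0 hα1 hη0 hbε,
    budget_bound_le hε hα0 (by linarith) (by linarith) hη0 hbε⟩
  · rcases outerCount_spec (G := G) (α := α) (b := b) (η := η) (M := M) (ε := ε) with h | h
    · rw [h]
      exact one_le_outerBudget hε hα0 hα1 hη0 hbε
    · exact h.1
  -- Accuracy comes from the decay estimate if the budget is exhausted, and from the maximum
  -- principle if the stopping test fired.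
  · rcases outerCount_spec (G := G) (α := α) (b := b) (η := η) (M := M) (ε := ε) with h | h
    · rw [output, h]
      exact error_outerBudget_le hd hα0 hα1 hη0 hb0 hm M hε v
    · exact error_le_of_stopTest hd hα0 hα1 h.2 v
  · exact stageWork_le_stageBound hd hα0 hα1 hη0.le M t (ht t) _
      (fun k hk => gradRatio_pos hd M t (ht t) hk)
      fun k hk => tauRate_mul_gradRatio_le hd hα0 hα1 hη0.le M t (ht t) hk
  · exact stageWork_le_stageBound hd hα0 hα1 hη0.le M t (ht t) _
      (fun k hk => updateRatio_pos hd M t (ht t) hk)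
      fun k hk => tauRate_mul_updateRatio_le hd hα0 hα1 hη0.le M t (ht t) hk
  · rw [qRatio, hη]
    congr 1
    ring
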